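/- Let $N\ge 1$, $1<p<\infty$ and $0<s<1$. For an open set $A\subset\mathbb{R}^N$ let $W^{s,p}(A)$ be the space of all $\psi\in L^p(A)$ with $$[\psi]_{W^{s,p}(A)}=\Big(\iint_{A\times A}\frac{|\psi(x)-\psi(y)|^p}{|x-y|^{N+sp}}\,dx\,dy\Big)^{1/p}<\infty,$$ and let $L^{p-1}_{sp}(\mathbb{R}^N)$ be the space of all $u\in L^{p-1}_{\rm loc}(\mathbb{R}^N)$ with $\int_{\mathbb{R}^N}\frac{|u(x)|^{p-1}}{1+|x|^{N+sp}}\,dx<\infty$. For $sp\neq N$ put $$(p^*_s)'=\frac{Np}{Np-N+sp}\ \text{ if } sp<N,\qquad (p^*_s)'=1\ \text{ if } sp>N.$$ Let $\Omega,\Omega'\subset\mathbb{R}^N$ be open and bounded with $\overline{\Omega}\subset\Omega'$. For $g\in L^{p-1}_{sp}(\mathbb{R}^N)$ put $$X^{s,p}_g(\Omega,\Omega')=\{v\in W^{s,p}(\Omega')\cap L^{p-1}_{sp}(\mathbb{R}^N)\,:\,v=g\text{ a.e. in }\mathbb{R}^N\setminus\Omega\}.$$ A function $u\in X^{s,p}_g(\Omega,\Omega')$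 is called a weak solution of the problem $$(-\Delta_p)^s u=f\ \text{ in }\Omega,\qquad u=g\ \text{ in }\mathbb{R}^N\setminus\Omega,$$ if for every $\varphi\in X^{s,p}_0(\Omega,\Omega')$ both of the following integrals converge absolutely and $$\iint_{\mathbb{R}^N\times\mathbb{R}^N}\frac{|u(x)-u(y)|^{p-2}(u(x)-u(y))\,(\varphi(x)-\varphi(y))}{|x-y|^{N+sp}}\,dx\,dy=\int_\Omega f\,\varphi\,dx .$$ **Proposition.** Let $f\in L^q(\Omega)$, where $q\in[1,\infty]$ satisfies $q\ge (p^*_s)'$ if $sp\neq N$, and $q>1$ if $sp=N$, and let $g\in W^{s,p}(\Omega')\cap L^{p-1}_{sp}(\mathbb{R}^N)$. Then the problem above has a weak solution $u\in X^{s,p}_g(\Omega,\Omega')$, and it is unique (up to equality almost everywhere in $\mathbb{R}^N$). -/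

import Mathlib

open MeasureTheory
open scoped ENNReal

noncomputable section

namespace FracPLap

/-- The `N`-dimensional Euclidean space. -/
abbrev E (N : ℕ) : Type := EuclideanSpace ℝ (Fin N)

/-- The monotone function `J_p(t) = |t|^(p-2) t` (for `p > 1` its value at `0` is `0`). -/
def J (p t : ℝ) : ℝ := |t| ^ (p - 2) * t

/-- The Sobolev-Slobodeckii seminorm `[u]_{W^{s,p}(A)}`, with values in `[0,∞]`. -/
def seminorm {N : ℕ} (s p : ℝ) (A : Set (E N)) (u : E N → ℝ) : ℝ≥0∞ :=
  (∫⁻ z in A ×ˢ A,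
    ENNReal.ofReal (|u z.1 - u z.2| ^ p / ‖z.1 - z.2‖ ^ ((N : ℝ) + s * p))) ^ (1 / p)

/-- `u ∈ W^{s,p}(A)`: the restriction of `u` to `A` is in `L^p(A)` and `[u]_{W^{s,p}(A)} < ∞`. -/
def MemW {N : ℕ} (s p : ℝ) (A : Set (E N)) (u : E N → ℝ) : Prop :=
  MemLp u (ENNReal.ofReal p) (volume.restrict A) ∧ seminorm s p A u < ∞

/-- `u` belongs to the tail space `L^q_α(ℝ^N)`, for `q > 0` and `α > 0`: it is measurable, its
`q`-th power is locally integrable, and `∫ |u|^q / (1 + |x|^(N+α)) dx < ∞`. -/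
def MemTail {N : ℕ} (q α : ℝ) (u : E N → ℝ) : Prop :=
  AEStronglyMeasurable u volume ∧
  (∀ K : Set (E N), IsCompact K → ∫⁻ x in K, ENNReal.ofReal (|u x| ^ q) < ∞) ∧
  ∫⁻ x : E N, ENNReal.ofReal (|u x| ^ q / (1 + ‖x‖ ^ ((N : ℝ) + α))) < ∞

/-- The space `X^{s,p}_g(Ω,Ω')` of the functions in `W^{s,p}(Ω') ∩ L^{p-1}_{sp}(ℝ^N)` that
coincide with `g` almost everywhere in `ℝ^N ∖ Ω`. -/
def X {N : ℕ} (s p : ℝ) (Ω Ω' : Set (E N)) (g : E N → ℝ) : Set (E N → ℝ) :=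
  {v | MemW s p Ω' v ∧ MemTail (p - 1) (s * p) v ∧ ∀ᵐ x ∂(volume : Measure (E N)), x ∉ Ω → v x = g x}

/-- The integrand
`J_p(u(x)-u(y)) (φ(x)-φ(y)) / |x-y|^(N+sp)` of the weak formulation, at `z = (x,y)`. -/
def weakIntegrand {N : ℕ} (s p : ℝ) (u φ : E N → ℝ) (z : E N × E N) : ℝ :=
  J p (u z.1 - u z.2) * (φ z.1 - φ z.2) / ‖z.1 - z.2‖ ^ ((N : ℝ) + s * p)

/-- `u ∈ X^{s,p}_g(Ω,Ω')` is a weak solution of `(-Δ_p)^s u = f` in `Ω`, `u = g` outside `Ω`: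
for every test function `φ ∈ X^{s,p}_0(Ω,Ω')` both integrals of the weak formulation converge
absolutely, and they are equal. -/
def IsWeakSolution {N : ℕ} (s p : ℝ) (Ω Ω' : Set (E N)) (f g u : E N → ℝ) : Prop :=
  u ∈ X s p Ω Ω' g ∧
  ∀ φ ∈ X s p Ω Ω' (fun _ => 0),
    Integrable (weakIntegrand s p u φ) (volume : Measure (E N × E N)) ∧
    IntegrableOn (fun x => f x * φ x) Ω ∧
    ∫ z : E N × E N, weakIntegrand s p u φ z = ∫ x in Ω, f x * φ x

/-- The exponent `(p^*_s)'`, for `s p ≠ N`. -/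
def conjExponent (N : ℕ) (s p : ℝ) : ℝ≥0∞ :=
  if s * p < N then ENNReal.ofReal (N * p / (N * p - N + s * p)) else 1

end FracPLap

end

open Filter Topology

noncomputable section

namespace FracPLap

/-! Write Du(x,y) = u(x) - u(y) and let k be the measure |x-y|^(-N-sp) dx dy. The equation is the
Euler-Lagrange equation of a convex functional, minimized over u = g + φ with φ vanishing off Ω. The
obvious energy ∫ |D(g+φ)|^p dk / p may be infinite, since g has finite p-energy only on Ω' × Ω' and
is only controlled to the power p-1 far away. So |D(g+φ)|^p is replaced by its excess `breg` over
the tangent line at Dg, and the tangent term J(Dg)Dφ that remains is moved into the linear part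
`linPart`. The excess is nonnegative and at most p (J(Dg+Dφ) - J(Dg)) Dφ, which is integrable
because the weak form at any element of X is a bounded functional of the test function
(`Admissible.exists_lintegral_J_le`).

That bound rests on two facts. For x in Ω and y outside Ω' the kernel is at most a multiple of the
tail weight of y (`Admissible.exists_kernel_le`). Test functions vanish on Ω' \ Ω, a set of positive
measure, whence a Poincaré inequality. The term with f is bounded by the Sobolev inequality when sp
≤ N and by Morrey's when sp > N, both proved here from averages over balls.

No weak compactness is needed: the scalar uniform convexity estimate `exists_abs_sub_rpow_le_gap`
makes every minimizing sequence Cauchy, and completeness with Fatou's lemma yields a minimizer. The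
tangent inequality and τ → 0 turn minimality into the weak equation. Uniqueness is strict
monotonicity of J, tested with the difference of two solutions, followed by Poincaré. -/

/-! ### Scalar inequalities for |t|^p and J_p. -/

lemma abs_J {p : ℝ} (hp : 1 < p) (t : ℝ) : |J p t| = |t| ^ (p - 1) := by
  unfold J
  rcases eq_or_ne t 0 with rfl | ht
  · simp [Real.zero_rpow (by linarith : p - 1 ≠ 0)]
  · rw [abs_mul, abs_of_nonneg (Real.rpow_nonneg (abs_nonneg t) _)]
    nth_rw 2 [← Real.rpow_one |t|]
    rw [← Real.rpow_add (abs_pos.2 ht)]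
    ring_nf

lemma J_mul_self {p : ℝ} (hp : 1 < p) (t : ℝ) : J p t * t = |t| ^ p := by
  unfold J
  rcases eq_or_ne t 0 with rfl | ht
  · simp [Real.zero_rpow (by linarith : p ≠ 0)]
  · rw [mul_assoc, ← abs_mul_abs_self, ← sq, ← Real.rpow_natCast |t| 2,
      ← Real.rpow_add (abs_pos.2 ht)]
    norm_num

lemma J_neg (p t : ℝ) : J p (-t) = -J p t := by simp [J]

lemma measurable_J (p : ℝ) : Measurable (J p) := by unfold J; fun_prop

lemma continuous_J {p : ℝ} (hp : 1 < p) : Continuous (J p) := by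
  rw [continuous_iff_continuousAt]
  intro t
  rcases eq_or_ne t 0 with rfl | ht
  · have h0 : J p 0 = 0 := by simp [J]
    rw [ContinuousAt, h0]
    have h : Tendsto (fun t : ℝ => |t| ^ (p - 1)) (𝓝 0) (𝓝 (|0| ^ (p - 1))) :=
      ((continuous_abs.tendsto 0).rpow_const (Or.inr (by linarith)))
    rw [abs_zero, Real.zero_rpow (by linarith)] at h
    exact (tendsto_zero_iff_abs_tendsto_zero _).2 (h.congr fun t => (abs_J hp t).symm)
  · unfold J
    exact (continuous_abs.continuousAt.rpow_const (Or.inl (abs_ne_zero.2 ht))).mul continuousAt_id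

/-- The tangent line inequality for the convex function `|·|^p`. -/
lemma abs_rpow_tangent {p : ℝ} (hp : 1 < p) (x y : ℝ) :
    |x| ^ p + p * J p x * (y - x) ≤ |y| ^ p := by
  have hpq : (p / (p - 1)).HolderConjugate p := (Real.HolderConjugate.conjExponent hp).symm
  -- Young's inequality for |x|^(p-1) and |y|, multiplied by p, is the claim once J_p(x)·y is
  -- bounded by |x|^(p-1)|y|.
  have h := Real.young_inequality_of_nonneg (Real.rpow_nonneg (abs_nonneg x) (p - 1))
    (abs_nonneg y) hpq
  rw [← Real.rpow_mul (abs_nonneg x)] at h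
  have e : (p - 1) * (p / (p - 1)) = p := by field_simp [(by linarith : p - 1 ≠ 0)]
  rw [e] at h
  have h2 : J p x * y ≤ |x| ^ (p - 1) * |y| := by
    rw [← abs_J hp, ← abs_mul]; exact le_abs_self _
  have h3 := J_mul_self hp x
  have hp0 : 0 < p := by linarith
  have h4 : p * (|x| ^ p / (p / (p - 1)) + |y| ^ p / p) = (p - 1) * |x| ^ p + |y| ^ p := by
    field_simp
  nlinarith [mul_le_mul_of_nonneg_left (h2.trans h) hp0.le]

/-- The midpoint convexity gap of `|·|^p`. -/
def gap (p a b : ℝ) : ℝ := (|a| ^ p + |b| ^ p) / 2 - |(a + b) / 2| ^ p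

/-- If |a| = |b| then a = -b and the midpoint is 0. Otherwise strict convexity of t^p on [0,∞)
applies to |a| and |b|, and the triangle inequality handles the midpoint. -/
lemma gap_pos {p : ℝ} (hp : 1 < p) {a b : ℝ} (hab : a ≠ b) : 0 < gap p a b := by
  unfold gap
  rcases eq_or_ne |a| |b| with h | h
  · have : a = -b := by
      rcases abs_eq_abs.1 h with h | h
      · exact absurd h hab
      · exact h
    subst this
    have hb : b ≠ 0 := by rintro rfl; simp at hab
    have : 0 < |b| ^ p := Real.rpow_pos_of_pos (abs_pos.2 hb) _
    simp [Real.zero_rpow (by linarith : p ≠ 0), this]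
  · have h1 := (strictConvexOn_rpow hp).2 (abs_nonneg a : |a| ∈ Set.Ici 0)
      (abs_nonneg b : |b| ∈ Set.Ici 0) h (by norm_num : (0 : ℝ) < 1 / 2)
      (by norm_num : (0 : ℝ) < 1 / 2) (by norm_num)
    simp only [smul_eq_mul] at h1
    have h2 : |(a + b) / 2| ^ p ≤ (1 / 2 * |a| + 1 / 2 * |b|) ^ p := by
      apply Real.rpow_le_rpow (abs_nonneg _) _ (by linarith)
      rw [abs_div, abs_two]
      linarith [abs_add_le a b]
    linarith

lemma gap_self (p a : ℝ) : gap p a a = 0 := by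
  unfold gap; rw [add_self_div_two, add_self_div_two, sub_self]

lemma gap_nonneg {p : ℝ} (hp : 1 < p) (a b : ℝ) : 0 ≤ gap p a b := by
  rcases eq_or_ne a b with rfl | h
  · exact (gap_self p a).ge
  · exact (gap_pos hp h).le

lemma continuous_abs_rpow {p : ℝ} (hp : 1 < p) : Continuous fun t : ℝ => |t| ^ p :=
  continuous_abs.rpow_const fun _ => Or.inr (by linarith)

lemma abs_mul_rpow (p c a : ℝ) : |c * a| ^ p = |c| ^ p * |a| ^ p := by
  rw [abs_mul, Real.mul_rpow (abs_nonneg _) (abs_nonneg _)]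

lemma gap_mul (p c a b : ℝ) : gap p (c * a) (c * b) = |c| ^ p * gap p a b := by
  unfold gap
  rw [← mul_add, mul_div_assoc, abs_mul_rpow, abs_mul_rpow, abs_mul_rpow]
  ring

/-- The constant 2^q, from a + b ≤ 2 max(a,b), also covers q < 1, which occurs as q = p - 1 when p <
2. -/
lemma add_rpow_le {q a b : ℝ} (hq : 0 ≤ q) (ha : 0 ≤ a) (hb : 0 ≤ b) :
    (a + b) ^ q ≤ 2 ^ q * (a ^ q + b ^ q) := by
  have h : (a + b) ^ q ≤ (2 * max a b) ^ q := by
    apply Real.rpow_le_rpow (by positivity) _ hq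
    linarith [le_max_left a b, le_max_right a b]
  refine h.trans ?_
  rw [Real.mul_rpow (by norm_num) (le_max_of_le_left ha)]
  gcongr
  rcases le_total a b with h | h
  · rw [max_eq_right h]; linarith [Real.rpow_nonneg ha q]
  · rw [max_eq_left h]; linarith [Real.rpow_nonneg hb q]

lemma abs_sub_rpow_le {q : ℝ} (hq : 0 ≤ q) (a b : ℝ) :
    |a - b| ^ q ≤ 2 ^ q * (|a| ^ q + |b| ^ q) :=
  (Real.rpow_le_rpow (abs_nonneg _) (abs_sub a b) hq).trans
    (add_rpow_le hq (abs_nonneg _) (abs_nonneg _))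

lemma abs_add_rpow_le {q : ℝ} (hq : 0 ≤ q) (a b : ℝ) :
    |a + b| ^ q ≤ 2 ^ q * (|a| ^ q + |b| ^ q) :=
  (Real.rpow_le_rpow (abs_nonneg _) (abs_add_le a b) hq).trans
    (add_rpow_le hq (abs_nonneg _) (abs_nonneg _))

/-- Uniform convexity of `|·|^p`, in an additive form valid for all `p > 1`. -/
lemma exists_abs_sub_rpow_le_gap {p : ℝ} (hp : 1 < p) {ε : ℝ} (hε : 0 < ε) :
    ∃ C : ℝ, 0 < C ∧ ∀ a b : ℝ, |a - b| ^ p ≤ C * gap p a b + ε * (|a| ^ p + |b| ^ p) := by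
  have hp0 : p ≠ 0 := by linarith
  -- Normalized pairs that are not close. S is compact and the gap is continuous and positive on it,
  -- so the gap has a positive lower bound c there; homogeneity then transports the bound to all
  -- pairs.
  set S : Set (ℝ × ℝ) := {z | |z.1| ^ p + |z.2| ^ p = 1 ∧ ε ≤ |z.1 - z.2| ^ p} with hS
  have c1 := (continuous_abs_rpow hp).comp (continuous_fst (X := ℝ) (Y := ℝ))
  have c2 := (continuous_abs_rpow hp).comp (continuous_snd (X := ℝ) (Y := ℝ))
  have c3 := (continuous_abs_rpow hp).comp ((continuous_fst (X := ℝ) (Y := ℝ)).sub continuous_snd)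
  have c4 := (continuous_abs_rpow hp).comp
    (((continuous_fst (X := ℝ) (Y := ℝ)).add continuous_snd).div_const 2)
  have hcl : IsClosed S :=
    (isClosed_eq (c1.add c2) continuous_const).inter (isClosed_le continuous_const c3)
  have hle : ∀ t : ℝ, |t| ^ p ≤ 1 → |t| ≤ 1 := fun t ht => by
    by_contra h
    push Not at h
    exact absurd (Real.one_lt_rpow h (by linarith)) (not_lt.2 ht)
  have hcpt : IsCompact S := by
    refine Metric.isCompact_of_isClosed_isBounded hcl
      ((Metric.isBounded_closedBall (x := (0 : ℝ × ℝ)) (r := 1)).subset ?_)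
    rintro ⟨a, b⟩ ⟨h, -⟩
    have ha := Real.rpow_nonneg (abs_nonneg a) p
    have hb := Real.rpow_nonneg (abs_nonneg b) p
    simp only at h
    rw [mem_closedBall_zero_iff, Prod.norm_mk, Real.norm_eq_abs, Real.norm_eq_abs]
    exact max_le (hle a (by linarith)) (hle b (by linarith))
  have key : ∃ c : ℝ, 0 < c ∧ ∀ z ∈ S, c ≤ gap p z.1 z.2 := by
    rcases S.eq_empty_or_nonempty with h | h
    · exact ⟨1, one_pos, by simp [h]⟩
    · have hc : Continuous fun z : ℝ × ℝ => gap p z.1 z.2 := ((c1.add c2).div_const 2).sub c4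
      obtain ⟨z, hz, hmin⟩ := hcpt.exists_isMinOn h hc.continuousOn
      refine ⟨_, gap_pos hp (a := z.1) (b := z.2) ?_, fun w hw => hmin hw⟩
      intro hh
      have := hz.2
      rw [hh, sub_self, abs_zero, Real.zero_rpow hp0] at this
      linarith
  obtain ⟨c, hc, hmin⟩ := key
  refine ⟨2 ^ p / c, by positivity, fun a b => ?_⟩
  have hg := gap_nonneg hp a b
  set T := |a| ^ p + |b| ^ p with hT
  have hTn : 0 ≤ T := by positivity
  have h1 : |a - b| ^ p ≤ 2 ^ p * T := abs_sub_rpow_le (by linarith) a b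
  rcases hTn.eq_or_lt with h0 | h0
  · rw [← h0] at h1 ⊢
    have : 0 ≤ 2 ^ p / c * gap p a b := by positivity
    linarith
  -- Close pairs are absorbed by the ε-term; the others are scaled by T^(-1/p) into S.
  · rcases lt_or_ge (|a - b| ^ p) (ε * T) with h2 | h2
    · have : 0 ≤ 2 ^ p / c * gap p a b := by positivity
      linarith
    · set k := T ^ (-(1 / p)) with hk
      have hk0 : 0 < k := Real.rpow_pos_of_pos h0 _
      have hkp : |k| ^ p = T⁻¹ := by
        rw [abs_of_pos hk0, hk, ← Real.rpow_mul hTn, neg_mul, one_div, inv_mul_cancel₀ hp0,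
          Real.rpow_neg_one]
      have hm := hmin (k * a, k * b) ⟨by
        simp only [abs_mul_rpow, hkp]
        rw [← mul_add, inv_mul_cancel₀ h0.ne'], by
        simp only [← mul_sub, abs_mul_rpow, hkp]
        rw [le_inv_mul_iff₀ h0]; linarith⟩
      simp only [gap_mul, hkp] at hm
      rw [le_inv_mul_iff₀ h0] at hm
      have h3 : T ≤ gap p a b / c := by rw [le_div_iff₀ hc]; exact hm
      have : 2 ^ p * T ≤ 2 ^ p / c * gap p a b := by
        calc 2 ^ p * T ≤ 2 ^ p * (gap p a b / c) := by gcongr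
          _ = _ := by ring
      have : 0 ≤ ε * T := by positivity
      linarith

/-- Average the tangent inequalities at a and at b, both evaluated at the midpoint. Strict
monotonicity of J_p thus follows from positivity of the gap. -/
lemma gap_le_J_sub_mul {p : ℝ} (hp : 1 < p) (a b : ℝ) :
    gap p a b ≤ p / 4 * ((J p a - J p b) * (a - b)) := by
  have h1 := abs_rpow_tangent hp a ((a + b) / 2)
  have h2 := abs_rpow_tangent hp b ((a + b) / 2)
  unfold gap
  nlinarith

lemma J_sub_mul_nonneg {p : ℝ} (hp : 1 < p) (a b : ℝ) : 0 ≤ (J p a - J p b) * (a - b) := by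
  have h := (gap_nonneg hp a b).trans (gap_le_J_sub_mul hp a b)
  by_contra! hh
  nlinarith

lemma eq_of_J_sub_mul_eq_zero {p : ℝ} (hp : 1 < p) {a b : ℝ}
    (h : (J p a - J p b) * (a - b) = 0) : a = b := by
  by_contra hab
  have h1 := (gap_pos hp hab).trans_le (gap_le_J_sub_mul hp a b)
  rw [h] at h1
  simp at h1

/-- The Bregman distance of `|·|^p`. -/
def breg (p a b : ℝ) : ℝ := |a + b| ^ p - |a| ^ p - p * J p a * b

lemma breg_nonneg {p : ℝ} (hp : 1 < p) (a b : ℝ) : 0 ≤ breg p a b := by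
  have := abs_rpow_tangent hp a (a + b)
  unfold breg
  rw [add_sub_cancel_left] at this
  linarith

/-- The tangent line is taken at the far endpoint a + b + c. With b = 0 this gives the upper bound
behind integrability; in general it replaces differentiation of the energy. -/
lemma breg_add_sub_le {p : ℝ} (hp : 1 < p) (a b c : ℝ) :
    breg p a (b + c) - breg p a b ≤ p * ((J p (a + b + c) - J p a) * c) := by
  have := abs_rpow_tangent hp (a + b + c) (a + b)
  unfold breg
  rw [← add_assoc a b c]
  nlinarith

lemma breg_zero {p : ℝ} (a : ℝ) : breg p a 0 = 0 := by simp [breg]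

lemma breg_le {p : ℝ} (hp : 1 < p) (a b : ℝ) :
    breg p a b ≤ p * ((J p (a + b) - J p a) * b) := by
  have := breg_add_sub_le hp a 0 b
  simpa [breg_zero] using this

/-- The subtracted terms are affine in the second argument, so passing to the Bregman distance
leaves the convexity gap of |·|^p unchanged. -/
lemma breg_midpoint (p a b c : ℝ) :
    (breg p a b + breg p a c) / 2 - breg p a ((b + c) / 2) = gap p (a + b) (a + c) := by
  unfold breg gap
  rw [show a + (b + c) / 2 = (a + b + (a + c)) / 2 by ring]
  ring

lemma continuous_breg {p : ℝ} (hp : 1 < p) (a : ℝ) : Continuous (breg p a) := by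
  unfold breg
  exact (((continuous_abs_rpow hp).comp (continuous_const.add continuous_id)).sub
    continuous_const).sub (continuous_const.mul continuous_id)

lemma measurable_breg (p : ℝ) : Measurable fun z : ℝ × ℝ => breg p z.1 z.2 := by
  unfold breg
  have := measurable_J p
  fun_prop

/-- Coercivity of the Bregman distance. -/
lemma exists_breg_ge {p : ℝ} (hp : 1 < p) :
    ∃ C : ℝ, 0 < C ∧ ∀ a b : ℝ, |b| ^ p ≤ C * (breg p a b + |a| ^ p) := by
  have h2 : (0 : ℝ) < 2 ^ p := by positivity
  -- With this ε, expanding |a+b|^p by the factor 2^p leaves only half of |b|^p on the right, which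
  -- is absorbed on the left.
  obtain ⟨C, hC, h⟩ := exists_abs_sub_rpow_le_gap hp (ε := 1 / (2 * 2 ^ p)) (by positivity)
  refine ⟨C + 2, by positivity, fun a b => ?_⟩
  have h1 := h (a + b) a
  rw [add_sub_cancel_left] at h1
  have h3 : gap p (a + b) a ≤ breg p a b / 2 := by
    have := breg_midpoint p a b 0
    rw [breg_zero, add_zero, add_zero, add_zero] at this
    linarith [breg_nonneg hp a (b / 2)]
  have h4 := abs_add_rpow_le (by linarith : 0 ≤ p) a b
  have h5 : 1 / (2 * 2 ^ p) * (|a + b| ^ p + |a| ^ p) ≤ 1 / 2 * |b| ^ p + |a| ^ p := by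
    have h21 : (1 : ℝ) ≤ 2 ^ p := Real.one_le_rpow (by norm_num) (by linarith)
    have ha : 0 ≤ |a| ^ p := by positivity
    rw [div_mul_eq_mul_div, div_le_iff₀ (by positivity)]
    nlinarith
  have ha : 0 ≤ |a| ^ p := by positivity
  have hb := breg_nonneg hp a b
  nlinarith

/-! ### The singular measure and differences of functions. -/

variable {N : ℕ} {s p : ℝ} {Ω Ω' : Set (E N)}

/-- The singular kernel `|x-y|^(-N-sp)`, with value `0` on the diagonal. -/
def kernel (N : ℕ) (s p : ℝ) (z : E N × E N) : ℝ≥0∞ :=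
  ENNReal.ofReal ((‖z.1 - z.2‖ ^ ((N : ℝ) + s * p))⁻¹)

/-- The measure `|x-y|^(-N-sp) dx dy`. -/
def kmeas (N : ℕ) (s p : ℝ) : Measure (E N × E N) := volume.withDensity (kernel N s p)

/-- The difference `u(x) - u(y)`. -/
def diff (u : E N → ℝ) (z : E N × E N) : ℝ := u z.1 - u z.2

lemma diff_add (u v : E N → ℝ) : diff (u + v) = diff u + diff v := by
  ext z; simp only [diff, Pi.add_apply]; ring

lemma diff_sub (u v : E N → ℝ) : diff (u - v) = diff u - diff v := by
  ext z; simp only [diff, Pi.sub_apply]; ring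

lemma diff_smul (c : ℝ) (u : E N → ℝ) : diff (c • u) = c • diff u := by
  ext z; simp only [diff, Pi.smul_apply, smul_eq_mul]; ring

lemma measurable_kernel : Measurable (kernel N s p) := by unfold kernel; fun_prop

lemma kmeas_absolutelyContinuous : kmeas N s p ≪ volume := withDensity_absolutelyContinuous _ _

lemma kernel_lt_top (z : E N × E N) : kernel N s p z < ∞ := ENNReal.ofReal_lt_top

lemma kernel_swap (z : E N × E N) : kernel N s p z.swap = kernel N s p z := by
  simp [kernel, norm_sub_rev]

lemma lintegral_kmeas (H : E N × E N → ℝ≥0∞) :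
    ∫⁻ z, H z ∂kmeas N s p = ∫⁻ z, kernel N s p z * H z :=
  lintegral_withDensity_eq_lintegral_mul_non_measurable _ measurable_kernel
    (Eventually.of_forall kernel_lt_top) H

lemma setLIntegral_kmeas {S : Set (E N × E N)} (hS : MeasurableSet S) (H : E N × E N → ℝ≥0∞) :
    ∫⁻ z in S, H z ∂kmeas N s p = ∫⁻ z in S, kernel N s p z * H z :=
  setLIntegral_withDensity_eq_setLIntegral_mul_non_measurable _ measurable_kernel H hS
    (Eventually.of_forall kernel_lt_top)

lemma eLpNorm_rpow_eq_lintegral {α : Type*} [MeasurableSpace α] {ν : Measure α} {p : ℝ}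
    (hp : 0 < p) (f : α → ℝ) :
    eLpNorm f (ENNReal.ofReal p) ν ^ p = ∫⁻ x, ‖f x‖ₑ ^ p ∂ν := by
  rw [eLpNorm_eq_lintegral_rpow_enorm_toReal (by simpa using hp) ENNReal.ofReal_ne_top,
    ENNReal.toReal_ofReal hp.le, ← ENNReal.rpow_mul, one_div_mul_cancel hp.ne', ENNReal.rpow_one]

lemma eLpNorm_eq_lintegral {α : Type*} [MeasurableSpace α] {ν : Measure α} {p : ℝ}
    (hp : 0 < p) (f : α → ℝ) :
    eLpNorm f (ENNReal.ofReal p) ν = (∫⁻ x, ‖f x‖ₑ ^ p ∂ν) ^ (1 / p) := by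
  rw [eLpNorm_eq_lintegral_rpow_enorm_toReal (by simpa using hp) ENNReal.ofReal_ne_top,
    ENNReal.toReal_ofReal hp.le]

lemma ofReal_abs_rpow {q : ℝ} (hq : 0 ≤ q) (t : ℝ) : ENNReal.ofReal (|t| ^ q) = ‖t‖ₑ ^ q := by
  rw [← ENNReal.ofReal_rpow_of_nonneg (abs_nonneg t) hq, ← Real.enorm_eq_ofReal_abs]

/-- Turns the Gagliardo seminorm into an L^p norm, so that Minkowski, Hölder and Fatou apply as in
any Lebesgue space. -/
lemma seminorm_eq (hp : 0 < p) {A : Set (E N)} (hA : MeasurableSet A) (u : E N → ℝ) :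
    seminorm s p A u = eLpNorm (diff u) (ENNReal.ofReal p) ((kmeas N s p).restrict (A ×ˢ A)) := by
  rw [eLpNorm_eq_lintegral hp, setLIntegral_kmeas (hA.prod hA), seminorm]
  congr 2
  ext z
  rw [div_eq_mul_inv, ENNReal.ofReal_mul (by positivity), ofReal_abs_rpow hp.le, mul_comm]
  rfl

lemma aesm_diff {u : E N → ℝ} (hu : AEStronglyMeasurable u volume) :
    AEStronglyMeasurable (diff u) (volume : Measure (E N × E N)) :=
  hu.comp_fst.sub hu.comp_snd

lemma aesm_diff_kmeas {u : E N → ℝ} (hu : AEStronglyMeasurable u volume) :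
    AEStronglyMeasurable (diff u) (kmeas N s p) :=
  (aesm_diff hu).mono_ac kmeas_absolutelyContinuous

lemma integrable_weakIntegrand_iff {u φ : E N → ℝ} :
    Integrable (weakIntegrand s p u φ) volume ↔
      Integrable (fun z => J p (diff u z) * diff φ z) (kmeas N s p) := by
  rw [kmeas, integrable_withDensity_iff_integrable_smul' measurable_kernel
    (Eventually.of_forall kernel_lt_top)]
  refine integrable_congr (Eventually.of_forall fun z => ?_)
  simp only [weakIntegrand, kernel, diff, smul_eq_mul]
  rw [ENNReal.toReal_ofReal (by positivity), div_eq_mul_inv, mul_comm]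

lemma integral_weakIntegrand {u φ : E N → ℝ} :
    ∫ z, weakIntegrand s p u φ z = ∫ z, J p (diff u z) * diff φ z ∂kmeas N s p := by
  rw [kmeas, integral_withDensity_eq_integral_toReal_smul measurable_kernel
    (Eventually.of_forall kernel_lt_top)]
  refine integral_congr_ae (Eventually.of_forall fun z => ?_)
  simp only [weakIntegrand, kernel, diff, smul_eq_mul]
  rw [ENNReal.toReal_ofReal (by positivity), div_eq_mul_inv, mul_comm]

/-! ### Pairs of domains, decay of the kernel, and splitting into local and tail parts. -/

/-- The standing assumptions on the exponents and on the pair of domains. -/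
structure Admissible (s p : ℝ) (Ω Ω' : Set (E N)) : Prop where
  one_le : 1 ≤ N
  one_lt : 1 < p
  s_pos : 0 < s
  isOpen : IsOpen Ω
  isOpen' : IsOpen Ω'
  isBounded : Bornology.IsBounded Ω
  isBounded' : Bornology.IsBounded Ω'
  closure_subset : closure Ω ⊆ Ω'

namespace Admissible

variable (h : Admissible s p Ω Ω')
include h

lemma p_pos : 0 < p := zero_lt_one.trans h.one_lt

lemma sp_pos : 0 < s * p := mul_pos h.s_pos h.p_pos

lemma exponent_pos : 0 < (N : ℝ) + s * p := by
  have := h.sp_pos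
  positivity

lemma subset : Ω ⊆ Ω' := subset_closure.trans h.closure_subset

lemma one_le_ofReal : 1 ≤ ENNReal.ofReal p := by
  rw [← ENNReal.ofReal_one]; exact ENNReal.ofReal_le_ofReal h.one_lt.le

lemma measure_lt_top : volume Ω < ∞ := h.isBounded.measure_lt_top

lemma measure'_lt_top : volume Ω' < ∞ := h.isBounded'.measure_lt_top

end Admissible

/-- The weight of the tail space. -/
def weight (N : ℕ) (s p : ℝ) (y : E N) : ℝ≥0∞ :=
  ENNReal.ofReal ((1 + ‖y‖ ^ ((N : ℝ) + s * p))⁻¹)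

lemma measurable_weight : Measurable (weight N s p) := by unfold weight; fun_prop

/-- The compact closure of Ω has positive distance δ to the complement of Ω', so |x-y| dominates
both a constant and a multiple of |y|. -/
lemma Admissible.exists_kernel_le (h : Admissible s p Ω Ω') :
    ∃ C : ℝ≥0∞, C ≠ ∞ ∧ ∀ x ∈ Ω, ∀ y ∉ Ω', kernel N s p (x, y) ≤ C * weight N s p y := by
  have hα := h.exponent_pos
  set α := (N : ℝ) + s * p with hαd
  obtain ⟨δ, hδ, hdist⟩ := (h.isBounded.isCompact_closure).exists_thickening_subset_open
    h.isOpen' h.closure_subset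
  obtain ⟨R, hR0, hR⟩ := h.isBounded.exists_pos_norm_le
  -- From |y| ≤ |x| + d ≤ R + d and d = |x-y| ≥ δ one gets |y| ≤ (1 + R/δ) d.
  set M := 1 + R / δ with hM
  have hM0 : 0 < M := by positivity
  refine ⟨ENNReal.ofReal ((δ ^ α)⁻¹ + M ^ α), ENNReal.ofReal_ne_top, fun x hx y hy => ?_⟩
  rw [kernel, weight, ← ENNReal.ofReal_mul (by positivity)]
  apply ENNReal.ofReal_le_ofReal
  rw [← hαd]
  have h1 : δ ≤ ‖x - y‖ := by
    by_contra! hlt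
    apply hy
    apply hdist
    rw [Metric.mem_thickening_iff]
    exact ⟨x, subset_closure hx, by rwa [dist_comm, dist_eq_norm]⟩
  set d := ‖x - y‖
  have hd : 0 < d := hδ.trans_le h1
  have h2 : ‖y‖ ≤ M * d := by
    have : ‖y‖ ≤ ‖x‖ + d := by
      have := norm_sub_norm_le y x
      rw [norm_sub_rev] at this
      linarith
    have h3 : R ≤ R / δ * d := by
      rw [div_mul_eq_mul_div, le_div_iff₀ hδ]; gcongr
    rw [hM, add_mul, one_mul]
    linarith [hR x hx]
  have h4 : ‖y‖ ^ α ≤ M ^ α * d ^ α := by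
    rw [← Real.mul_rpow hM0.le hd.le]
    exact Real.rpow_le_rpow (norm_nonneg _) h2 hα.le
  have h5 : 1 ≤ (δ ^ α)⁻¹ * d ^ α := by
    rw [le_inv_mul_iff₀ (by positivity), mul_one]
    exact Real.rpow_le_rpow hδ.le h1 hα.le
  have hdα : 0 < d ^ α := by positivity
  rw [← div_eq_mul_inv, le_div_iff₀ (by positivity), inv_mul_le_iff₀ hdα]
  linarith

/-- The weight is comparable to (1+|y|)^(-N-sp), which is integrable because sp > 0. -/
lemma Admissible.lintegral_weight_lt_top (h : Admissible s p Ω Ω') :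
    ∫⁻ y, weight N s p y < ∞ := by
  have hα := h.exponent_pos
  have hfin := finite_integral_one_add_norm (E := E N) (μ := volume) (r := (N : ℝ) + s * p)
    (by rw [finrank_euclideanSpace_fin]; linarith [h.sp_pos])
  refine lt_of_le_of_lt (lintegral_mono (g := fun y => ENNReal.ofReal (2 ^ ((N : ℝ) + s * p)) *
    ENNReal.ofReal ((1 + ‖y‖) ^ (-((N : ℝ) + s * p)))) fun y => ?_) ?_
  · dsimp only
    rw [weight, ← ENNReal.ofReal_mul (by positivity)]
    apply ENNReal.ofReal_le_ofReal
    have h1 := add_rpow_le hα.le zero_le_one (norm_nonneg y)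
    rw [Real.one_rpow] at h1
    rw [Real.rpow_neg (by positivity), ← div_eq_mul_inv, le_div_iff₀ (by positivity),
      inv_mul_le_iff₀ (by positivity)]
    linarith
  · rw [lintegral_const_mul _ (by fun_prop)]
    exact ENNReal.mul_lt_top ENNReal.ofReal_lt_top hfin

lemma lintegral_eq_setLIntegral_of_ae {α : Type*} [MeasurableSpace α] {ν : Measure α}
    {S : Set α} (hS : MeasurableSet S) {f : α → ℝ≥0∞} (hf : ∀ᵐ x ∂ν, x ∉ S → f x = 0) :
    ∫⁻ x, f x ∂ν = ∫⁻ x in S, f x ∂ν := by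
  rw [← lintegral_add_compl f hS]
  have : ∫⁻ x in Sᶜ, f x ∂ν = 0 := by
    rw [setLIntegral_congr_fun_ae hS.compl (g := fun _ => 0) hf, lintegral_zero]
  rw [this, add_zero]

lemma ae_fst {P : E N → Prop} (h : ∀ᵐ x ∂(volume : Measure (E N)), P x) :
    ∀ᵐ z ∂(volume : Measure (E N × E N)), P z.1 :=
  Measure.quasiMeasurePreserving_fst.ae h

lemma ae_snd {P : E N → Prop} (h : ∀ᵐ x ∂(volume : Measure (E N)), P x) :
    ∀ᵐ z ∂(volume : Measure (E N × E N)), P z.2 :=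
  Measure.quasiMeasurePreserving_snd.ae h

lemma setLIntegral_prod {A B : Set (E N)} {H : E N × E N → ℝ≥0∞}
    (hH : AEMeasurable H volume) :
    ∫⁻ z in A ×ˢ B, H z = ∫⁻ x in A, ∫⁻ y in B, H (x, y) := by
  rw [Measure.volume_eq_prod, ← Measure.prod_restrict, lintegral_prod]
  rw [Measure.prod_restrict]
  exact hH.restrict

/-- Integrals against `|x-y|^(-N-sp) dx dy` of symmetric functions that vanish off `Ω` in both
variables are controlled by a local part and a tail part. -/
lemma Admissible.exists_lintegral_kmeas_le (h : Admissible s p Ω Ω') :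
    ∃ C : ℝ≥0∞, C ≠ ∞ ∧ ∀ H : E N × E N → ℝ≥0∞, AEMeasurable H volume →
      (∀ z, H z.swap = H z) → (∀ᵐ z, z.1 ∉ Ω → z.2 ∉ Ω → H z = 0) →
      ∫⁻ z, H z ∂kmeas N s p ≤ ∫⁻ z in Ω' ×ˢ Ω', H z ∂kmeas N s p +
        C * ∫⁻ x in Ω, ∫⁻ y in Ω'ᶜ, H (x, y) * weight N s p y := by
  obtain ⟨C, hC, hk⟩ := h.exists_kernel_le
  refine ⟨2 * C, ENNReal.mul_ne_top (by simp) hC, fun H hH hsymm hzero => ?_⟩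
  have mΩ := h.isOpen.measurableSet
  have mΩ' := h.isOpen'.measurableSet
  -- The two mixed pieces have equal integrals by symmetry, whence the factor 2 in the constant; the
  -- last piece contributes nothing.
  have hcover : (Set.univ : Set (E N × E N)) ⊆
      (Ω' ×ˢ Ω') ∪ ((Ω ×ˢ Ω'ᶜ) ∪ ((Ω'ᶜ ×ˢ Ω) ∪ (Ωᶜ ×ˢ Ωᶜ))) := by
    rintro ⟨x, y⟩ -
    have h1 : x ∈ Ω → x ∈ Ω' := fun hx => h.subset hx
    have h2 : y ∈ Ω → y ∈ Ω' := fun hx => h.subset hx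
    simp only [Set.mem_union, Set.mem_prod, Set.mem_compl_iff]
    tauto
  have hfar : ∫⁻ z in Ω ×ˢ Ω'ᶜ, H z ∂kmeas N s p ≤
      C * ∫⁻ x in Ω, ∫⁻ y in Ω'ᶜ, H (x, y) * weight N s p y := by
    rw [setLIntegral_kmeas (mΩ.prod mΩ'.compl),
      setLIntegral_prod (H := fun z => kernel N s p z * H z)
        (measurable_kernel.aemeasurable.mul hH), ← lintegral_const_mul' _ _ hC]
    refine setLIntegral_mono' mΩ fun x hx => ?_
    rw [← lintegral_const_mul' _ _ hC]
    refine setLIntegral_mono' mΩ'.compl fun y hy => ?_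
    calc kernel N s p (x, y) * H (x, y) ≤ C * weight N s p y * H (x, y) := by
          gcongr; exact hk x hx y hy
      _ = _ := by ring
  have hswap : ∫⁻ z in Ω'ᶜ ×ˢ Ω, H z ∂kmeas N s p = ∫⁻ z in Ω ×ˢ Ω'ᶜ, H z ∂kmeas N s p := by
    rw [setLIntegral_kmeas (mΩ.prod mΩ'.compl), setLIntegral_kmeas (mΩ'.compl.prod mΩ)]
    have hmp : MeasurePreserving (Prod.swap : E N × E N → E N × E N) volume volume :=
      Measure.measurePreserving_swap
    rw [← hmp.setLIntegral_comp_preimage_emb MeasurableEquiv.prodComm.measurableEmbedding]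
    rw [Set.preimage_swap_prod]
    simp only [kernel_swap, hsymm]
  have hnull : ∫⁻ z in Ωᶜ ×ˢ Ωᶜ, H z ∂kmeas N s p = 0 := by
    rw [setLIntegral_congr_fun_ae (mΩ.compl.prod mΩ.compl) (g := fun _ => 0), lintegral_zero]
    filter_upwards [kmeas_absolutelyContinuous.ae_le hzero] with z hz hz'
    exact hz hz'.1 hz'.2
  calc ∫⁻ z, H z ∂kmeas N s p = ∫⁻ z in Set.univ, H z ∂kmeas N s p := by
        rw [Measure.restrict_univ]
    _ ≤ _ := lintegral_mono_set hcover
    _ ≤ _ := (lintegral_union_le _ _ _)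
    _ ≤ ∫⁻ z in Ω' ×ˢ Ω', H z ∂kmeas N s p + (∫⁻ z in Ω ×ˢ Ω'ᶜ, H z ∂kmeas N s p +
        (∫⁻ z in Ω'ᶜ ×ˢ Ω, H z ∂kmeas N s p + ∫⁻ z in Ωᶜ ×ˢ Ωᶜ, H z ∂kmeas N s p)) := by
      gcongr
      refine (lintegral_union_le _ _ _).trans ?_
      gcongr
      exact lintegral_union_le _ _ _
    _ ≤ _ := by
      rw [hnull, hswap, add_zero, ← two_mul, mul_assoc 2 C]
      gcongr

/-! ### The Poincaré inequality and the space of test functions. -/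

/-- The norm of the space of test functions. -/
def vnorm (s p : ℝ) (Ω' : Set (E N)) (φ : E N → ℝ) : ℝ≥0∞ :=
  eLpNorm (diff φ) (ENNReal.ofReal p) ((kmeas N s p).restrict (Ω' ×ˢ Ω'))

/-- If Ω' \ closure Ω were empty, Ω' would equal closure Ω and be clopen, hence empty or the whole
space by connectedness. Nonemptiness and boundedness exclude both. -/
lemma Admissible.measure_diff_pos (h : Admissible s p Ω Ω') (hne : Ω.Nonempty) :
    0 < volume (Ω' \ Ω) := by
  have hne' : (Ω' \ closure Ω).Nonempty := by
    by_contra hcon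
    rw [Set.not_nonempty_iff_eq_empty, Set.sdiff_eq_empty] at hcon
    have heq : Ω' = closure Ω := hcon.antisymm h.closure_subset
    have hclopen : IsClopen Ω' := ⟨heq ▸ isClosed_closure, h.isOpen'⟩
    rcases isClopen_iff.1 hclopen with h0 | h1
    · exact (hne.mono h.subset).ne_empty h0
    · have hb := h.isBounded'
      rw [h1] at hb
      have : Nontrivial (E N) := by
        have : Nonempty (Fin N) := ⟨⟨0, h.one_le⟩⟩
        infer_instance
      exact NormedSpace.unbounded_univ ℝ (E N) hb
  exact ((h.isOpen'.sdiff isClosed_closure).measure_pos volume hne').trans_le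
    (measure_mono (Set.sdiff_subset_sdiff_right subset_closure))

/-- The fractional Poincaré inequality for functions that vanish off `Ω`. -/
lemma Admissible.exists_eLpNorm_le_vnorm (h : Admissible s p Ω Ω') :
    ∃ C : ℝ≥0∞, C ≠ ∞ ∧ ∀ φ : E N → ℝ, AEStronglyMeasurable φ volume →
      (∀ᵐ x, x ∉ Ω → φ x = 0) →
      eLpNorm φ (ENNReal.ofReal p) volume ≤ C * vnorm s p Ω' φ := by
  have hp := h.p_pos
  have mΩ := h.isOpen.measurableSet
  have mΩ' := h.isOpen'.measurableSet
  rcases Ω.eq_empty_or_nonempty with he | hne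
  · refine ⟨0, by simp, fun φ _ h0 => ?_⟩
    have : φ =ᵐ[volume] 0 := by
      filter_upwards [h0] with x hx
      exact hx (by simp [he])
    rw [eLpNorm_congr_ae this, eLpNorm_zero]
    exact zero_le
  obtain ⟨R, hR0, hR⟩ := h.isBounded'.exists_pos_norm_le
  -- A lower bound for the kernel off the diagonal of Ω' × Ω', where distances are at most 2R.
  set κ : ℝ≥0∞ := ENNReal.ofReal (((2 * R) ^ ((N : ℝ) + s * p))⁻¹) with hκ
  have hκ0 : κ ≠ 0 := by
    rw [hκ, Ne, ENNReal.ofReal_eq_zero, not_le]; positivity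
  set m := volume (Ω' \ Ω) with hm
  have hm0 : m ≠ 0 := (h.measure_diff_pos hne).ne'
  have hm1 : m ≠ ∞ := ((measure_mono Set.sdiff_subset).trans_lt h.measure'_lt_top).ne
  have hκm : κ * m ≠ 0 := mul_ne_zero hκ0 hm0
  have hκm' : κ * m ≠ ∞ := ENNReal.mul_ne_top ENNReal.ofReal_ne_top hm1
  refine ⟨((κ * m)⁻¹) ^ (1 / p), ENNReal.rpow_ne_top_of_nonneg (by positivity)
    (ENNReal.inv_ne_top.2 hκm), fun φ hφ h0 => ?_⟩
  rw [vnorm, eLpNorm_eq_lintegral hp, eLpNorm_eq_lintegral hp,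
    ← ENNReal.mul_rpow_of_nonneg _ _ (by positivity)]
  refine ENNReal.rpow_le_rpow ?_ (by positivity)
  rw [← ENNReal.div_eq_inv_mul, ENNReal.le_div_iff_mul_le (Or.inl hκm) (Or.inl hκm'),
    setLIntegral_kmeas (mΩ'.prod mΩ'), lintegral_eq_setLIntegral_of_ae mΩ (f := fun x => ‖φ x‖ₑ ^ p)
      (by filter_upwards [h0] with x hx hx'; simp [hx hx', hp])]
  -- For y in Ω' \ Ω the difference φ(x) - φ(y) is φ(x), so integrating in y over this set of
  -- measure m recovers |φ(x)|^p.
  calc (∫⁻ x in Ω, ‖φ x‖ₑ ^ p) * (κ * m)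
      = ∫⁻ x in Ω, ∫⁻ y in Ω' \ Ω, κ * ‖φ x‖ₑ ^ p := by
        rw [← lintegral_mul_const' _ _ hκm']
        refine lintegral_congr fun x => ?_
        rw [setLIntegral_const]
        ring
    _ = ∫⁻ z in Ω ×ˢ (Ω' \ Ω), κ * ‖φ z.1‖ₑ ^ p := by
        rw [setLIntegral_prod (H := fun z => κ * ‖φ z.1‖ₑ ^ p)]
        exact (hφ.comp_fst.enorm.pow_const p).const_mul κ
    _ ≤ ∫⁻ z in Ω ×ˢ (Ω' \ Ω), kernel N s p z * ‖diff φ z‖ₑ ^ p := by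
        refine setLIntegral_mono_ae' (mΩ.prod (mΩ'.diff mΩ)) ?_
        filter_upwards [ae_snd h0] with z hz hz'
        rw [diff, hz hz'.2.2, sub_zero]
        gcongr
        rw [hκ, kernel]
        apply ENNReal.ofReal_le_ofReal
        have hne : z.1 ≠ z.2 := fun hh => hz'.2.2 (hh ▸ hz'.1)
        have hpos : 0 < ‖z.1 - z.2‖ := norm_pos_iff.2 (sub_ne_zero.2 hne)
        gcongr
        · exact h.exponent_pos.le
        · linarith [norm_sub_le z.1 z.2, hR _ (h.subset hz'.1), hR _ hz'.2.1]
    _ ≤ _ := lintegral_mono_set (Set.prod_mono h.subset Set.sdiff_subset)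

/-- Membership in the space of test functions, up to the Poincaré inequality. -/
structure IsTest (s p : ℝ) (Ω Ω' : Set (E N)) (φ : E N → ℝ) : Prop where
  aesm : AEStronglyMeasurable φ volume
  ae_zero : ∀ᵐ x ∂(volume : Measure (E N)), x ∉ Ω → φ x = 0
  vnorm_lt_top : vnorm s p Ω' φ < ∞

lemma vnorm_add_le (hp : 1 < p) {φ ψ : E N → ℝ} (hφ : AEStronglyMeasurable φ volume)
    (hψ : AEStronglyMeasurable ψ volume) :
    vnorm s p Ω' (φ + ψ) ≤ vnorm s p Ω' φ + vnorm s p Ω' ψ := by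
  unfold vnorm
  rw [diff_add]
  refine eLpNorm_add_le (aesm_diff_kmeas hφ).restrict (aesm_diff_kmeas hψ).restrict ?_
  rw [← ENNReal.ofReal_one]; exact ENNReal.ofReal_le_ofReal hp.le

lemma vnorm_smul (c : ℝ) (φ : E N → ℝ) : vnorm s p Ω' (c • φ) = ‖c‖ₑ * vnorm s p Ω' φ := by
  unfold vnorm
  rw [diff_smul, eLpNorm_const_smul]

lemma IsTest.add (hp : 1 < p) {φ ψ : E N → ℝ} (hφ : IsTest s p Ω Ω' φ) (hψ : IsTest s p Ω Ω' ψ) :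
    IsTest s p Ω Ω' (φ + ψ) where
  aesm := hφ.aesm.add hψ.aesm
  ae_zero := by
    filter_upwards [hφ.ae_zero, hψ.ae_zero] with x h1 h2 hx
    simp [h1 hx, h2 hx]
  vnorm_lt_top := (vnorm_add_le hp hφ.aesm hψ.aesm).trans_lt
    (ENNReal.add_lt_top.2 ⟨hφ.vnorm_lt_top, hψ.vnorm_lt_top⟩)

lemma IsTest.smul (c : ℝ) {φ : E N → ℝ} (hφ : IsTest s p Ω Ω' φ) : IsTest s p Ω Ω' (c • φ) where
  aesm := hφ.aesm.const_smul c
  ae_zero := by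
    filter_upwards [hφ.ae_zero] with x h1 hx
    simp [h1 hx]
  vnorm_lt_top := by
    rw [vnorm_smul]; exact ENNReal.mul_lt_top enorm_lt_top hφ.vnorm_lt_top

lemma IsTest.neg {φ : E N → ℝ} (hφ : IsTest s p Ω Ω' φ) : IsTest s p Ω Ω' (-φ) := by
  simpa using hφ.smul (-1)

lemma IsTest.sub (hp : 1 < p) {φ ψ : E N → ℝ} (hφ : IsTest s p Ω Ω' φ) (hψ : IsTest s p Ω Ω' ψ) :
    IsTest s p Ω Ω' (φ - ψ) := by
  rw [sub_eq_add_neg]; exact hφ.add hp hψ.neg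

lemma isTest_zero : IsTest s p Ω Ω' (0 : E N → ℝ) where
  aesm := aestronglyMeasurable_zero
  ae_zero := by simp
  vnorm_lt_top := by
    have : diff (0 : E N → ℝ) = 0 := by ext z; simp [diff]
    simp [vnorm, this]

lemma memTail_iff {q α : ℝ} (hq : 0 ≤ q) {u : E N → ℝ} :
    MemTail q α u ↔ AEStronglyMeasurable u volume ∧
      (∀ K : Set (E N), IsCompact K → ∫⁻ x in K, ‖u x‖ₑ ^ q < ∞) ∧
      ∫⁻ x : E N, ‖u x‖ₑ ^ q * ENNReal.ofReal ((1 + ‖x‖ ^ ((N : ℝ) + α))⁻¹) < ∞ := by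
  unfold MemTail
  simp only [div_eq_mul_inv, ofReal_abs_rpow hq,
    ENNReal.ofReal_mul (Real.rpow_nonneg (abs_nonneg _) q)]

lemma enorm_add_rpow_le {q : ℝ} (hq : 0 ≤ q) (a b : ℝ) :
    ‖a + b‖ₑ ^ q ≤ ENNReal.ofReal (2 ^ q) * (‖a‖ₑ ^ q + ‖b‖ₑ ^ q) := by
  rw [← ofReal_abs_rpow hq, ← ofReal_abs_rpow hq, ← ofReal_abs_rpow hq,
    ← ENNReal.ofReal_add (by positivity) (by positivity), ← ENNReal.ofReal_mul (by positivity)]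
  exact ENNReal.ofReal_le_ofReal (abs_add_rpow_le hq a b)

lemma enorm_sub_rpow_le {q : ℝ} (hq : 0 ≤ q) (a b : ℝ) :
    ‖a - b‖ₑ ^ q ≤ ENNReal.ofReal (2 ^ q) * (‖a‖ₑ ^ q + ‖b‖ₑ ^ q) := by
  rw [sub_eq_add_neg, ← enorm_neg b]; exact enorm_add_rpow_le hq a (-b)

lemma MemTail.add {q α : ℝ} (hq : 0 ≤ q) {u v : E N → ℝ} (hu : MemTail q α u)
    (hv : MemTail q α v) : MemTail q α (u + v) := by
  rw [memTail_iff hq] at *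
  refine ⟨hu.1.add hv.1, fun K hK => ?_, ?_⟩
  · refine lt_of_le_of_lt (lintegral_mono fun x => enorm_add_rpow_le hq (u x) (v x)) ?_
    rw [lintegral_const_mul' _ _ ENNReal.ofReal_ne_top,
      lintegral_add_left' (hu.1.enorm.pow_const q).restrict]
    exact ENNReal.mul_lt_top ENNReal.ofReal_lt_top
      (ENNReal.add_lt_top.2 ⟨hu.2.1 K hK, hv.2.1 K hK⟩)
  · refine lt_of_le_of_lt (lintegral_mono fun x =>
      mul_le_mul_left (enorm_add_rpow_le hq (u x) (v x)) _) ?_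
    simp only [mul_assoc, add_mul]
    rw [lintegral_const_mul' _ _ ENNReal.ofReal_ne_top,
      lintegral_add_left']
    · exact ENNReal.mul_lt_top ENNReal.ofReal_lt_top (ENNReal.add_lt_top.2 ⟨hu.2.2, hv.2.2⟩)
    · exact (hu.1.enorm.pow_const q).mul (by fun_prop)

lemma enorm_rpow_sub_one_le (hp : 1 < p) (t : ℝ) : ‖t‖ₑ ^ (p - 1) ≤ 1 + ‖t‖ₑ ^ p := by
  rcases le_total ‖t‖ₑ 1 with h | h
  · exact (ENNReal.rpow_le_one h (by linarith)).trans le_self_add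
  · exact (ENNReal.rpow_le_rpow_of_exponent_le h (by linarith)).trans le_add_self

lemma Admissible.isTest_memLp (h : Admissible s p Ω Ω') {φ : E N → ℝ}
    (hφ : IsTest s p Ω Ω' φ) : MemLp φ (ENNReal.ofReal p) volume := by
  obtain ⟨C, hC, hb⟩ := h.exists_eLpNorm_le_vnorm
  exact ⟨hφ.aesm, (hb φ hφ.aesm hφ.ae_zero).trans_lt
    (ENNReal.mul_lt_top hC.lt_top hφ.vnorm_lt_top)⟩

lemma Admissible.isTest_memW (h : Admissible s p Ω Ω') {φ : E N → ℝ}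
    (hφ : IsTest s p Ω Ω' φ) : MemW s p Ω' φ := by
  refine ⟨(h.isTest_memLp hφ).restrict _, ?_⟩
  rw [seminorm_eq h.p_pos h.isOpen'.measurableSet]
  exact hφ.vnorm_lt_top

lemma Admissible.isTest_memTail (h : Admissible s p Ω Ω') {φ : E N → ℝ}
    (hφ : IsTest s p Ω Ω' φ) : MemTail (p - 1) (s * p) φ := by
  have hp1 := h.one_lt
  have hL : ∫⁻ x, ‖φ x‖ₑ ^ p < ∞ := by
    rw [← eLpNorm_rpow_eq_lintegral h.p_pos]
    exact ENNReal.rpow_lt_top_of_nonneg h.p_pos.le (h.isTest_memLp hφ).2.ne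
  have hfin : ∀ K : Set (E N), volume K < ∞ → ∫⁻ x in K, ‖φ x‖ₑ ^ (p - 1) < ∞ := by
    intro K hK
    refine lt_of_le_of_lt (lintegral_mono fun x => enorm_rpow_sub_one_le hp1 (φ x)) ?_
    rw [lintegral_add_left measurable_const, setLIntegral_const, one_mul]
    exact ENNReal.add_lt_top.2 ⟨hK, (setLIntegral_le_lintegral _ _).trans_lt hL⟩
  rw [memTail_iff (by linarith)]
  refine ⟨hφ.aesm, fun K hK => hfin K hK.measure_lt_top, ?_⟩
  refine lt_of_le_of_lt ?_ (hfin Ω h.measure_lt_top)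
  rw [← lintegral_eq_setLIntegral_of_ae h.isOpen.measurableSet (f := fun x => ‖φ x‖ₑ ^ (p - 1))]
  · refine lintegral_mono fun x => mul_le_of_le_one_right' ?_
    rw [ENNReal.ofReal_le_one]
    apply inv_le_one_of_one_le₀
    linarith [Real.rpow_nonneg (norm_nonneg x) ((N : ℝ) + s * p)]
  · filter_upwards [hφ.ae_zero] with x hx hx'
    simp [hx hx', hp1]

/-- The L^p condition is automatic by Poincaré, and the tail conditions follow from |t|^(p-1) ≤ 1 +
|t|^p on sets of finite measure. -/
lemma Admissible.mem_X_zero_iff (h : Admissible s p Ω Ω') {φ : E N → ℝ} :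
    φ ∈ X s p Ω Ω' (fun _ => 0) ↔ IsTest s p Ω Ω' φ := by
  refine ⟨fun hφ => ⟨hφ.2.1.1, hφ.2.2, ?_⟩, fun hφ => ⟨h.isTest_memW hφ, h.isTest_memTail hφ,
    hφ.ae_zero⟩⟩
  have := hφ.1.2
  rwa [seminorm_eq h.p_pos h.isOpen'.measurableSet] at this

lemma Admissible.vnorm_lt_top_of_memW (h : Admissible s p Ω Ω') {u : E N → ℝ}
    (hu : MemW s p Ω' u) : vnorm s p Ω' u < ∞ := by
  have := hu.2
  rwa [seminorm_eq h.p_pos h.isOpen'.measurableSet] at this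

lemma Admissible.memW_add (h : Admissible s p Ω Ω') {u v : E N → ℝ}
    (hu : AEStronglyMeasurable u volume) (hv : AEStronglyMeasurable v volume)
    (hu' : MemW s p Ω' u) (hv' : MemW s p Ω' v) : MemW s p Ω' (u + v) := by
  refine ⟨hu'.1.add hv'.1, ?_⟩
  rw [seminorm_eq h.p_pos h.isOpen'.measurableSet]
  exact (vnorm_add_le h.one_lt hu hv).trans_lt
    (ENNReal.add_lt_top.2 ⟨h.vnorm_lt_top_of_memW hu', h.vnorm_lt_top_of_memW hv'⟩)

lemma Admissible.add_mem_X (h : Admissible s p Ω Ω') {g φ : E N → ℝ} (hg : MemW s p Ω' g)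
    (hg' : MemTail (p - 1) (s * p) g) (hφ : IsTest s p Ω Ω' φ) : g + φ ∈ X s p Ω Ω' g := by
  refine ⟨h.memW_add hg'.1 hφ.aesm hg (h.isTest_memW hφ),
    hg'.add (by linarith [h.one_lt]) (h.isTest_memTail hφ), ?_⟩
  filter_upwards [hφ.ae_zero] with x hx hx'
  simp [hx hx']

lemma Admissible.isTest_sub (h : Admissible s p Ω Ω') {g u v : E N → ℝ}
    (hu : u ∈ X s p Ω Ω' g) (hv : v ∈ X s p Ω Ω' g) : IsTest s p Ω Ω' (u - v) where
  aesm := hu.2.1.1.sub hv.2.1.1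
  ae_zero := by
    filter_upwards [hu.2.2, hv.2.2] with x h1 h2 hx
    simp [h1 hx, h2 hx]
  vnorm_lt_top := by
    rw [sub_eq_add_neg]
    refine (vnorm_add_le h.one_lt hu.2.1.1 hv.2.1.1.neg).trans_lt ?_
    have : vnorm s p Ω' (-v) = vnorm s p Ω' v := by
      have := vnorm_smul (s := s) (p := p) (Ω' := Ω') (-1) v
      simpa using this
    rw [this]
    exact ENNReal.add_lt_top.2 ⟨h.vnorm_lt_top_of_memW hu.1, h.vnorm_lt_top_of_memW hv.1⟩

/-! ### Boundedness of the weak form. -/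

/-- Hölder with the exponents p/(p-1) and p. -/
lemma lintegral_rpow_mul_le {α : Type*} [MeasurableSpace α] {ν : Measure α} (hp : 1 < p)
    {u φ : α → ℝ} (hu : AEStronglyMeasurable u ν) (hφ : AEStronglyMeasurable φ ν) :
    ∫⁻ x, ‖u x‖ₑ ^ (p - 1) * ‖φ x‖ₑ ∂ν ≤
      eLpNorm u (ENNReal.ofReal p) ν ^ (p - 1) * eLpNorm φ (ENNReal.ofReal p) ν := by
  have hp0 : 0 < p := by linarith
  have hpq : (p / (p - 1)).HolderConjugate p := (Real.HolderConjugate.conjExponent hp).symm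
  have := ENNReal.lintegral_mul_le_Lp_mul_Lq ν hpq (hu.enorm.pow_const (p - 1)) hφ.enorm
  simp only [Pi.mul_apply] at this
  refine this.trans_eq ?_
  simp only [← ENNReal.rpow_mul]
  rw [mul_div_cancel₀ p (by linarith : p - 1 ≠ 0), eLpNorm_eq_lintegral hp0,
    eLpNorm_eq_lintegral hp0, ← ENNReal.rpow_mul]
  congr 2
  field_simp

lemma enorm_J (hp : 1 < p) (t : ℝ) : ‖J p t‖ₑ = ‖t‖ₑ ^ (p - 1) := by
  rw [← ofReal_abs_rpow (by linarith), ← abs_J hp, Real.enorm_eq_ofReal_abs]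

/-- The weak form at `u` is a bounded functional of the test function. -/
lemma Admissible.exists_lintegral_J_le (h : Admissible s p Ω Ω') {u : E N → ℝ}
    (hu : MemW s p Ω' u) (hu' : MemTail (p - 1) (s * p) u) :
    ∃ C : ℝ≥0∞, C ≠ ∞ ∧ ∀ φ : E N → ℝ, AEStronglyMeasurable φ volume →
      (∀ᵐ x, x ∉ Ω → φ x = 0) →
      ∫⁻ z, ‖J p (diff u z) * diff φ z‖ₑ ∂kmeas N s p ≤ C * vnorm s p Ω' φ := by
  have hp := h.one_lt
  obtain ⟨C₁, hC₁, hsplit⟩ := h.exists_lintegral_kmeas_le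
  obtain ⟨C₂, hC₂, hpoinc⟩ := h.exists_eLpNorm_le_vnorm
  have hW₀ := h.lintegral_weight_lt_top
  rw [memTail_iff (by linarith)] at hu'
  obtain ⟨hum, -, hW₁⟩ := hu'
  set W₀ := ∫⁻ y, weight N s p y with hW₀d
  set W₁ : ℝ≥0∞ := ∫⁻ y, ‖u y‖ₑ ^ (p - 1) * weight N s p y with hW₁d
  have hW₁' : W₁ < ∞ := hW₁
  set P := ENNReal.ofReal p
  set c := ENNReal.ofReal (2 ^ (p - 1))
  set A := eLpNorm u P (volume.restrict Ω) ^ (p - 1) with hA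
  have hAfin : A ≠ ∞ := ENNReal.rpow_ne_top_of_nonneg (by linarith)
    (hu.1.mono_measure (Measure.restrict_mono_set _ h.subset)).2.ne
  set B := eLpNorm (fun _ : E N => (1 : ℝ)) P (volume.restrict Ω) ^ (p - 1) with hB
  have hBfin : B ≠ ∞ := by
    have : IsFiniteMeasure (volume.restrict Ω) := ⟨by simpa using h.measure_lt_top⟩
    exact ENNReal.rpow_ne_top_of_nonneg (by linarith) (memLp_const (1 : ℝ)).2.ne
  -- The first term is Hölder on Ω' × Ω'. In the tail part |u(x)-u(y)|^(p-1) splits into an x-part,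
  -- giving W₀ A, and a y-part, giving W₁; the latter leaves ∫ |φ| over Ω, treated as Hölder against
  -- the constant 1, hence B.
  refine ⟨vnorm s p Ω' u ^ (p - 1) + C₁ * (c * (W₀ * A + W₁ * B) * C₂), ?_, fun φ hφ h0 => ?_⟩
  · refine ENNReal.add_ne_top.2 ⟨ENNReal.rpow_ne_top_of_nonneg (by linarith)
      (h.vnorm_lt_top_of_memW hu).ne, ENNReal.mul_ne_top hC₁ (ENNReal.mul_ne_top
      (ENNReal.mul_ne_top ENNReal.ofReal_ne_top (ENNReal.add_ne_top.2
        ⟨ENNReal.mul_ne_top hW₀.ne hAfin, ENNReal.mul_ne_top hW₁'.ne hBfin⟩)) hC₂)⟩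
  · have hms : AEMeasurable (fun z => ‖J p (diff u z) * diff φ z‖ₑ) volume :=
      (((measurable_J p).comp_aemeasurable (aesm_diff hum).aemeasurable).mul
        (aesm_diff hφ).aemeasurable).enorm
    refine (hsplit _ hms ?_ ?_).trans ?_
    · intro z
      have e : ∀ w : E N → ℝ, diff w z.swap = -diff w z := fun w => by simp [diff]
      rw [e, e, J_neg, neg_mul_neg]
    · filter_upwards [ae_fst h0, ae_snd h0] with z h1 h2 h3 h4
      simp [diff, h1 h3, h2 h4]
    rw [add_mul]
    simp only [enorm_mul, enorm_J hp]
    refine add_le_add ?_ ?_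
    · exact lintegral_rpow_mul_le hp (aesm_diff_kmeas hum).restrict (aesm_diff_kmeas hφ).restrict
    rw [mul_assoc C₁]
    gcongr
    calc ∫⁻ x in Ω, ∫⁻ y in Ω'ᶜ, ‖diff u (x, y)‖ₑ ^ (p - 1) * ‖diff φ (x, y)‖ₑ * weight N s p y
        ≤ ∫⁻ x in Ω, c * (W₀ * (‖u x‖ₑ ^ (p - 1) * ‖φ x‖ₑ) +
            W₁ * (‖(1 : ℝ)‖ₑ ^ (p - 1) * ‖φ x‖ₑ)) := by
          refine lintegral_mono fun x => ?_
          calc ∫⁻ y in Ω'ᶜ, ‖diff u (x, y)‖ₑ ^ (p - 1) * ‖diff φ (x, y)‖ₑ * weight N s p y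
              ≤ ∫⁻ y in Ω'ᶜ, (c * ‖φ x‖ₑ) * (‖u x‖ₑ ^ (p - 1) * weight N s p y +
                  ‖u y‖ₑ ^ (p - 1) * weight N s p y) := by
                refine setLIntegral_mono_ae' h.isOpen'.measurableSet.compl ?_
                filter_upwards [h0] with y hy hy'
                rw [diff, diff, hy fun hyΩ => hy' (h.subset hyΩ), sub_zero]
                calc _ ≤ (c * (‖u x‖ₑ ^ (p - 1) + ‖u y‖ₑ ^ (p - 1))) * ‖φ x‖ₑ * weight N s p y := by
                      gcongr
                      exact enorm_sub_rpow_le (by linarith) _ _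
                  _ = _ := by ring
            _ ≤ ∫⁻ y, (c * ‖φ x‖ₑ) * (‖u x‖ₑ ^ (p - 1) * weight N s p y +
                  ‖u y‖ₑ ^ (p - 1) * weight N s p y) := setLIntegral_le_lintegral _ _
            _ = (c * ‖φ x‖ₑ) * (‖u x‖ₑ ^ (p - 1) * W₀ + W₁) := by
                rw [lintegral_const_mul' _ _ (ENNReal.mul_ne_top ENNReal.ofReal_ne_top enorm_ne_top),
                  lintegral_add_left (measurable_weight.const_mul _),
                  lintegral_const_mul _ measurable_weight]
            _ = _ := by
                simp only [enorm_one, ENNReal.one_rpow]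
                ring
      _ = c * (W₀ * (∫⁻ x in Ω, ‖u x‖ₑ ^ (p - 1) * ‖φ x‖ₑ) +
            W₁ * ∫⁻ x in Ω, ‖(1 : ℝ)‖ₑ ^ (p - 1) * ‖φ x‖ₑ) := by
          rw [lintegral_const_mul' _ _ ENNReal.ofReal_ne_top, lintegral_add_left',
            lintegral_const_mul' _ _ hW₀.ne, lintegral_const_mul' _ _ hW₁'.ne]
          exact (((hum.enorm.pow_const (p - 1)).mul hφ.enorm).const_mul W₀).restrict
      _ ≤ c * (W₀ * (A * eLpNorm φ P (volume.restrict Ω)) +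
            W₁ * (B * eLpNorm φ P (volume.restrict Ω))) := by
          gcongr
          · exact lintegral_rpow_mul_le hp hum.restrict hφ.restrict
          · exact lintegral_rpow_mul_le hp aestronglyMeasurable_const hφ.restrict
      _ = c * (W₀ * A + W₁ * B) * eLpNorm φ P (volume.restrict Ω) := by ring
      _ ≤ c * (W₀ * A + W₁ * B) * (C₂ * vnorm s p Ω' φ) := by
          gcongr
          exact (eLpNorm_mono_measure _ Measure.restrict_le_self).trans (hpoinc φ hφ h0)
      _ = _ := by ring

/-- The global Gagliardo seminorm of a function vanishing off `Ω` is controlled by the local one. -/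
lemma Admissible.exists_eLpNorm_diff_le (h : Admissible s p Ω Ω') :
    ∃ C : ℝ≥0∞, C ≠ ∞ ∧ ∀ φ : E N → ℝ, AEStronglyMeasurable φ volume →
      (∀ᵐ x, x ∉ Ω → φ x = 0) →
      eLpNorm (diff φ) (ENNReal.ofReal p) (kmeas N s p) ≤ C * vnorm s p Ω' φ := by
  have hp := h.p_pos
  obtain ⟨C₁, hC₁, hsplit⟩ := h.exists_lintegral_kmeas_le
  obtain ⟨C₂, hC₂, hpoinc⟩ := h.exists_eLpNorm_le_vnorm
  have hW₀ := h.lintegral_weight_lt_top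
  set W₀ := ∫⁻ y, weight N s p y with hW₀d
  refine ⟨(1 + C₁ * (W₀ * C₂ ^ p)) ^ (1 / p), ENNReal.rpow_ne_top_of_nonneg (by positivity)
    (ENNReal.add_ne_top.2 ⟨by simp, ENNReal.mul_ne_top hC₁ (ENNReal.mul_ne_top hW₀.ne
      (ENNReal.rpow_ne_top_of_nonneg hp.le hC₂))⟩), fun φ hφ h0 => ?_⟩
  have e : vnorm s p Ω' φ = (vnorm s p Ω' φ ^ p) ^ (1 / p) := by
    rw [← ENNReal.rpow_mul, mul_one_div_cancel hp.ne', ENNReal.rpow_one]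
  rw [eLpNorm_eq_lintegral hp, e, ← ENNReal.mul_rpow_of_nonneg _ _ (by positivity)]
  refine ENNReal.rpow_le_rpow ?_ (by positivity)
  have hms : AEMeasurable (fun z => ‖diff φ z‖ₑ ^ p) volume := (aesm_diff hφ).enorm.pow_const p
  refine (hsplit _ hms ?_ ?_).trans ?_
  · intro z
    have e : diff φ z.swap = -diff φ z := by simp [diff]
    rw [e, enorm_neg]
  · filter_upwards [ae_fst h0, ae_snd h0] with z h1 h2 h3 h4
    simp [diff, h1 h3, h2 h4, hp]
  rw [add_mul, one_mul, vnorm, eLpNorm_rpow_eq_lintegral hp, mul_assoc C₁]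
  gcongr
  calc ∫⁻ x in Ω, ∫⁻ y in Ω'ᶜ, ‖diff φ (x, y)‖ₑ ^ p * weight N s p y
      ≤ ∫⁻ x in Ω, W₀ * ‖φ x‖ₑ ^ p := by
        refine lintegral_mono fun x => ?_
        rw [mul_comm W₀, hW₀d, ← lintegral_const_mul _ measurable_weight]
        refine (setLIntegral_mono_ae' h.isOpen'.measurableSet.compl ?_).trans
          (setLIntegral_le_lintegral Ω'ᶜ _)
        filter_upwards [h0] with y hy hy'
        rw [diff, hy fun hyΩ => hy' (h.subset hyΩ), sub_zero]
    _ = W₀ * ∫⁻ x in Ω, ‖φ x‖ₑ ^ p := lintegral_const_mul' _ _ hW₀.ne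
    _ ≤ W₀ * eLpNorm φ (ENNReal.ofReal p) volume ^ p := by
        rw [eLpNorm_rpow_eq_lintegral hp]
        gcongr
        exact Measure.restrict_le_self
    _ ≤ W₀ * (C₂ * vnorm s p Ω' φ) ^ p := by
        gcongr
        exact hpoinc φ hφ h0
    _ = _ := by
        rw [ENNReal.mul_rpow_of_nonneg _ _ hp.le, vnorm, eLpNorm_rpow_eq_lintegral hp, mul_assoc]

/-! ### The fractional Sobolev inequality by pointwise interpolation. -/

lemma lintegral_rpow_le_of_le {α : Type*} [MeasurableSpace α] {ν : Measure α} {a b : ℝ}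
    (ha : 0 < a) (hab : a ≤ b) {F : α → ℝ≥0∞} (hF : AEMeasurable F ν) :
    (∫⁻ x, F x ^ a ∂ν) ^ (1 / a) ≤ (∫⁻ x, F x ^ b ∂ν) ^ (1 / b) * ν Set.univ ^ (1 / a - 1 / b) := by
  have := eLpNorm'_le_eLpNorm'_mul_rpow_measure_univ ha hab hF.aestronglyMeasurable
  simpa [eLpNorm'_eq_lintegral_enorm] using this

/-- The Gagliardo energy density of `φ` at the point `x`. -/
def density (s p : ℝ) (φ : E N → ℝ) (x : E N) : ℝ≥0∞ :=
  ∫⁻ y, kernel N s p (x, y) * ‖φ x - φ y‖ₑ ^ p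

lemma lintegral_density (hp : 0 < p) {φ : E N → ℝ} (hφ : AEStronglyMeasurable φ volume) :
    ∫⁻ x, density s p φ x = eLpNorm (diff φ) (ENNReal.ofReal p) (kmeas N s p) ^ p := by
  rw [eLpNorm_rpow_eq_lintegral hp, lintegral_kmeas, Measure.volume_eq_prod, lintegral_prod]
  · rfl
  · exact measurable_kernel.aemeasurable.mul ((aesm_diff hφ).enorm.pow_const p)

lemma aemeasurable_density {φ : E N → ℝ} (hφ : AEStronglyMeasurable φ volume) :
    AEMeasurable (density s p φ) volume :=
  (measurable_kernel.aemeasurable.mul ((aesm_diff hφ).enorm.pow_const p)).lintegral_prod_right'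

/-- On the ball r^(N+sp) times the kernel is at least 1 off the diagonal, and at y = x the integrand
vanishes. -/
lemma setLIntegral_closedBall_le (hp : 0 < p) (hα : 0 ≤ (N : ℝ) + s * p) (φ : E N → ℝ) (x : E N)
    {r : ℝ} (hr : 0 ≤ r) :
    ∫⁻ y in Metric.closedBall x r, ‖φ x - φ y‖ₑ ^ p ≤
      ENNReal.ofReal (r ^ ((N : ℝ) + s * p)) * density s p φ x := by
  rw [density, ← lintegral_const_mul' _ _ ENNReal.ofReal_ne_top]
  refine (setLIntegral_mono' measurableSet_closedBall fun y hy => ?_).trans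
    (setLIntegral_le_lintegral _ _)
  rcases eq_or_ne x y with rfl | hxy
  · simp [hp]
  · have hpos : 0 < ‖x - y‖ := norm_pos_iff.2 (sub_ne_zero.2 hxy)
    have hle : ‖x - y‖ ≤ r := by
      rw [Metric.mem_closedBall, dist_comm, dist_eq_norm] at hy; exact hy
    rw [← mul_assoc, kernel, ← ENNReal.ofReal_mul (by positivity)]
    refine le_mul_of_one_le_left' ?_
    rw [ENNReal.one_le_ofReal, ← div_eq_mul_inv, one_le_div (by positivity)]
    exact Real.rpow_le_rpow hpos.le hle hα

lemma volume_closedBall (x : E N) {r : ℝ} (hr : 0 ≤ r) :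
    volume (Metric.closedBall x r) =
      ENNReal.ofReal (r ^ (N : ℝ) * (volume (Metric.ball (0 : E N) 1)).toReal) := by
  rw [Measure.addHaar_closedBall _ x hr, finrank_euclideanSpace_fin, Real.rpow_natCast,
    ENNReal.ofReal_mul (by positivity), ENNReal.ofReal_toReal Metric.isBounded_ball.measure_lt_top.ne]

lemma volume_ball_toReal_pos : 0 < (volume (Metric.ball (0 : E N) 1)).toReal :=
  ENNReal.toReal_pos (Metric.measure_ball_pos _ _ one_pos).ne'
    Metric.isBounded_ball.measure_lt_top.ne

/-- The value of a function at a point is controlled by the local energy and an average. -/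
lemma exists_abs_le_density {t : ℝ} (hp : 1 < p) (hs : 0 < s) (ht : 1 ≤ t) :
    ∃ c : ℝ, 0 < c ∧ ∀ φ : E N → ℝ, AEStronglyMeasurable φ volume →
      eLpNorm φ (ENNReal.ofReal t) volume ≠ ∞ → ∀ x, density s p φ x ≠ ∞ → ∀ r : ℝ, 0 < r →
      |φ x| ≤ c * (r ^ s * (density s p φ x).toReal ^ (1 / p) +
        r ^ (-(N / t)) * (eLpNorm φ (ENNReal.ofReal t) volume).toReal) := by
  have hp0 : 0 < p := by linarith
  have ht0 : 0 < t := by linarith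
  set b := (volume (Metric.ball (0 : E N) 1)).toReal with hb
  have hb0 : 0 < b := volume_ball_toReal_pos
  refine ⟨b ^ (-(1 / p)) + b ^ (-(1 / t)), by positivity, fun φ hφ hU x hG r hr => ?_⟩
  set U := eLpNorm φ (ENNReal.ofReal t) volume with hUd
  set G := density s p φ x with hGd
  have hα : 0 ≤ (N : ℝ) + s * p := by positivity
  set v := r ^ (N : ℝ) * b with hv
  have hv0 : 0 < v := by positivity
  set B := Metric.closedBall x r with hB
  have hV : volume B = ENNReal.ofReal v := volume_closedBall x hr.le
  have hφx : AEMeasurable (fun y => ‖φ x - φ y‖ₑ) (volume.restrict B) :=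
    (aestronglyMeasurable_const.sub hφ).enorm.restrict
  have h1 : ∫⁻ y in B, ‖φ x - φ y‖ₑ ≤
      (ENNReal.ofReal (r ^ ((N : ℝ) + s * p)) * G) ^ (1 / p) * ENNReal.ofReal v ^ (1 - 1 / p) := by
    have := lintegral_rpow_le_of_le one_pos hp.le hφx
    simp only [ENNReal.rpow_one, div_one, Measure.restrict_apply_univ, hV] at this
    refine this.trans ?_
    gcongr
    exact setLIntegral_closedBall_le hp0 hα φ x hr.le
  have h2 : ∫⁻ y in B, ‖φ y‖ₑ ≤ U * ENNReal.ofReal v ^ (1 - 1 / t) := by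
    have := lintegral_rpow_le_of_le one_pos ht (ν := volume.restrict B) hφ.enorm.restrict
    simp only [ENNReal.rpow_one, div_one, Measure.restrict_apply_univ, hV] at this
    refine this.trans ?_
    rw [hUd, eLpNorm_eq_lintegral ht0]
    gcongr
    exact Measure.restrict_le_self
  -- Integrate |φ(x)| ≤ |φ(x)-φ(y)| + |φ(y)| in y over the ball. After division by its volume the
  -- powers of r are (N+sp)/p - N/p = s and -N/t.
  have h3 : ‖φ x‖ₑ * ENNReal.ofReal v ≤
      (ENNReal.ofReal (r ^ ((N : ℝ) + s * p)) * G) ^ (1 / p) * ENNReal.ofReal v ^ (1 - 1 / p) +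
        U * ENNReal.ofReal v ^ (1 - 1 / t) := by
    refine le_trans ?_ (add_le_add h1 h2)
    rw [← hV, ← setLIntegral_const, ← lintegral_add_left' hφx]
    refine lintegral_mono fun y => ?_
    simpa using enorm_add_le (φ x - φ y) (φ y)
  have f1 : (ENNReal.ofReal (r ^ ((N : ℝ) + s * p)) * G) ^ (1 / p) *
      ENNReal.ofReal v ^ (1 - 1 / p) ≠ ∞ :=
    ENNReal.mul_ne_top (ENNReal.rpow_ne_top_of_nonneg (by positivity)
      (ENNReal.mul_ne_top ENNReal.ofReal_ne_top hG)) (ENNReal.rpow_ne_top_of_nonneg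
        (sub_nonneg.2 ((div_le_one hp0).2 hp.le)) ENNReal.ofReal_ne_top)
  have f2 : U * ENNReal.ofReal v ^ (1 - 1 / t) ≠ ∞ :=
    ENNReal.mul_ne_top hU (ENNReal.rpow_ne_top_of_nonneg
        (sub_nonneg.2 ((div_le_one ht0).2 ht)) ENNReal.ofReal_ne_top)
  have h4 := ENNReal.toReal_mono (ENNReal.add_ne_top.2 ⟨f1, f2⟩) h3
  rw [ENNReal.toReal_add f1 f2] at h4
  simp only [ENNReal.toReal_mul, ← ENNReal.toReal_rpow, toReal_enorm, Real.norm_eq_abs,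
    ENNReal.toReal_ofReal hv0.le] at h4
  rw [ENNReal.toReal_ofReal (by positivity)] at h4
  set γ := G.toReal with hγ
  set W := U.toReal with hW
  have hγ0 : 0 ≤ γ := ENNReal.toReal_nonneg
  have hW0 : 0 ≤ W := ENNReal.toReal_nonneg
  have e1 : (r ^ ((N : ℝ) + s * p) * γ) ^ (1 / p) * v ^ (1 - 1 / p) =
      (b ^ (-(1 / p)) * (r ^ s * γ ^ (1 / p))) * v := by
    rw [Real.mul_rpow (by positivity) hγ0, ← Real.rpow_mul hr.le, sub_eq_add_neg,
      Real.rpow_add hv0, Real.rpow_one]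
    have : v ^ (-(1 / p)) = r ^ (-(N / p)) * b ^ (-(1 / p)) := by
      rw [hv, Real.mul_rpow (by positivity) hb0.le, ← Real.rpow_mul hr.le]
      congr 2; ring
    rw [this]
    have : r ^ (((N : ℝ) + s * p) * (1 / p)) = r ^ (N / p) * r ^ s := by
      rw [← Real.rpow_add hr]; congr 1; field_simp
    rw [this, Real.rpow_neg hr.le]
    have : r ^ ((N : ℝ) / p) ≠ 0 := by positivity
    field_simp
  have e2 : W * v ^ (1 - 1 / t) = (b ^ (-(1 / t)) * (r ^ (-(N / t)) * W)) * v := by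
    rw [sub_eq_add_neg, Real.rpow_add hv0, Real.rpow_one]
    have : v ^ (-(1 / t)) = r ^ (-(N / t)) * b ^ (-(1 / t)) := by
      rw [hv, Real.mul_rpow (by positivity) hb0.le, ← Real.rpow_mul hr.le]
      congr 2; ring
    rw [this]; ring
  rw [e1, e2, ← add_mul] at h4
  have h5 := le_of_mul_le_mul_right h4 hv0
  refine h5.trans ?_
  have k1 : 0 ≤ b ^ (-(1 / p)) := by positivity
  have k2 : 0 ≤ b ^ (-(1 / t)) := by positivity
  have k3 : 0 ≤ r ^ s * γ ^ (1 / p) := by positivity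
  have k4 : 0 ≤ r ^ (-(N / t)) * W := by positivity
  nlinarith [mul_nonneg k1 k4, mul_nonneg k2 k3]

/-- Optimization in r: the choice r^(s+m) = U/γ equalizes the two terms. If γ = 0, letting r → ∞
forces A = 0. -/
lemma rpow_le_of_forall_le {A γ U c m : ℝ} (hA : 0 ≤ A) (hγ : 0 ≤ γ) (hU : 0 < U) (hc : 0 < c)
    (hs : 0 < s) (hm : 0 < m) (h : ∀ r : ℝ, 0 < r → A ≤ c * (r ^ s * γ + r ^ (-m) * U)) :
    A ^ (s + m) ≤ (2 * c) ^ (s + m) * (γ ^ m * U ^ s) := by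
  have hsm : 0 < s + m := by positivity
  rcases hγ.eq_or_lt with rfl | hγ0
  · have hA0 : A ≤ 0 := by
      have : Tendsto (fun r : ℝ => c * (r ^ s * 0 + r ^ (-m) * U)) atTop (𝓝 0) := by
        have := ((tendsto_rpow_neg_atTop hm).mul_const U).const_mul c
        simpa using this
      exact ge_of_tendsto this ((eventually_gt_atTop 0).mono h)
    rw [le_antisymm hA0 hA, Real.zero_rpow hsm.ne']
    positivity
  · set r := (U / γ) ^ (1 / (s + m)) with hr
    have hr0 : 0 < r := by positivity
    have hrp : r ^ s * r ^ m = U / γ := by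
      rw [← Real.rpow_add hr0, hr, ← Real.rpow_mul (by positivity), one_div_mul_cancel hsm.ne',
        Real.rpow_one]
    have hY : r ^ (-m) * U = r ^ s * γ := by
      rw [Real.rpow_neg hr0.le]
      have : r ^ m ≠ 0 := by positivity
      field_simp at hrp ⊢
      linarith
    have h1 := h r hr0
    have h2 : (r ^ s * γ) ^ (s + m) = γ ^ m * U ^ s := by
      rw [add_comm s m, Real.rpow_add (by positivity), ← hY]
      nth_rw 1 [hY]
      rw [Real.mul_rpow (by positivity) hγ, Real.mul_rpow (by positivity) hU.le,
        ← Real.rpow_mul hr0.le, ← Real.rpow_mul hr0.le]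
      have : r ^ (s * m) * r ^ (-m * s) = 1 := by
        rw [← Real.rpow_add hr0]; ring_nf; exact Real.rpow_zero r
      calc _ = (r ^ (s * m) * r ^ (-m * s)) * (γ ^ m * U ^ s) := by ring
        _ = _ := by rw [this, one_mul]
    rw [← h2, ← Real.mul_rpow (by positivity) (by positivity)]
    refine Real.rpow_le_rpow hA ?_ hsm.le
    rw [hY] at h1
    linarith

/-- Pointwise interpolation between the energy density and a Lebesgue norm. -/
lemma exists_enorm_rpow_le {t : ℝ} (hN : 1 ≤ N) (hp : 1 < p) (hs : 0 < s) (ht : 1 ≤ t) :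
    ∃ c : ℝ≥0∞, c ≠ ∞ ∧ ∀ φ : E N → ℝ, AEStronglyMeasurable φ volume →
      eLpNorm φ (ENNReal.ofReal t) volume ≠ ∞ → eLpNorm φ (ENNReal.ofReal t) volume ≠ 0 →
      ∀ x, density s p φ x ≠ ∞ →
      ‖φ x‖ₑ ^ t ≤ c * (density s p φ x ^ (N / (s + N / t) / p) *
        eLpNorm φ (ENNReal.ofReal t) volume ^ (t - N / (s + N / t))) := by
  obtain ⟨c, hc, h⟩ := exists_abs_le_density (N := N) hp hs ht
  have hp0 : 0 < p := by linarith
  have ht0 : 0 < t := by linarith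
  have hN0 : (0 : ℝ) < N := by exact_mod_cast hN
  refine ⟨ENNReal.ofReal ((2 * c) ^ t), ENNReal.ofReal_ne_top, fun φ hφ hU hU0 x hG => ?_⟩
  have h1 := rpow_le_of_forall_le (abs_nonneg (φ x)) (by positivity) (ENNReal.toReal_pos hU0 hU) hc
    hs (by positivity : 0 < N / t) (h φ hφ hU x hG)
  set U := eLpNorm φ (ENNReal.ofReal t) volume
  set G := density s p φ x
  have hsm : 0 < s + N / t := by positivity
  have h2 := Real.rpow_le_rpow (by positivity) h1 (by positivity : 0 ≤ t / (s + N / t))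
  rw [← Real.rpow_mul (abs_nonneg _), mul_div_cancel₀ _ hsm.ne',
    Real.mul_rpow (by positivity) (by positivity), ← Real.rpow_mul (by positivity),
    mul_div_cancel₀ _ hsm.ne', Real.mul_rpow (x := (_ ^ _) ^ _) (by positivity) (by positivity),
    ← Real.rpow_mul (x := ENNReal.toReal _) (by positivity),
    ← Real.rpow_mul (x := ENNReal.toReal _) (by positivity),
    ← Real.rpow_mul (x := ENNReal.toReal _) (by positivity)] at h2
  have e1 : 1 / p * (N / t) * (t / (s + N / t)) = N / (s + N / t) / p := by field_simp
  have e2 : s * (t / (s + N / t)) = t - N / (s + N / t) := by field_simp; ring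
  rw [e1, e2] at h2
  have he2 : 0 ≤ t - N / (s + N / t) := by rw [← e2]; positivity
  rw [← ofReal_abs_rpow ht0.le]
  refine (ENNReal.ofReal_le_ofReal h2).trans_eq ?_
  rw [ENNReal.ofReal_mul (by positivity), ENNReal.ofReal_mul (by positivity),
    ← ENNReal.ofReal_rpow_of_nonneg ENNReal.toReal_nonneg (by positivity),
    ← ENNReal.ofReal_rpow_of_nonneg ENNReal.toReal_nonneg he2, ENNReal.ofReal_toReal hU,
    ENNReal.ofReal_toReal hG]

/-- The subcritical and critical fractional Sobolev inequality on a set of finite measure, for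
functions already known to lie in the target space. -/
lemma exists_sobolev_of_ne_top {t : ℝ} (hN : 1 ≤ N) (hp : 1 < p) (hs : 0 < s) (ht : 1 ≤ t)
    (htp : (N : ℝ) ≤ s * p + N * p / t) (mΩ : MeasurableSet Ω) (hΩ : volume Ω < ∞) :
    ∃ C : ℝ≥0∞, C ≠ ∞ ∧ ∀ φ : E N → ℝ, AEStronglyMeasurable φ volume →
      (∀ᵐ x, x ∉ Ω → φ x = 0) → eLpNorm φ (ENNReal.ofReal t) volume ≠ ∞ →
      eLpNorm φ (ENNReal.ofReal t) volume ≤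
        C * eLpNorm (diff φ) (ENNReal.ofReal p) (kmeas N s p) := by
  obtain ⟨c, hc, hpt⟩ := exists_enorm_rpow_le (N := N) hN hp hs ht
  have hp0 : 0 < p := by linarith
  have ht0 : 0 < t := by linarith
  have hN0 : (0 : ℝ) < N := by exact_mod_cast hN
  -- The energy density enters the pointwise bound with power a/p. The hypothesis on t says a ≤ p,
  -- so this power is at most 1 and Jensen on Ω applies.
  set a := N / (s + N / t) with ha
  have ha0 : 0 < a := by positivity
  have hap : a ≤ p := by
    rw [ha, div_le_iff₀ (by positivity)]
    calc (N : ℝ) ≤ _ := htp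
      _ = _ := by ring
  have hexp : 0 ≤ 1 / (a / p) - 1 := by
    rw [one_div_div, sub_nonneg, one_le_div ha0]; exact hap
  -- Using c + 1 instead of c keeps the constant nonzero when Ω is not null, so the bound stays
  -- valid when the right-hand seminorm is infinite.
  refine ⟨(c + 1) ^ (1 / a) * volume Ω ^ ((1 / (a / p) - 1) * (1 / p)), ENNReal.mul_ne_top
    (ENNReal.rpow_ne_top_of_nonneg (by positivity) (by simpa using hc))
    (ENNReal.rpow_ne_top_of_nonneg (by positivity) hΩ.ne), fun φ hφ h0 hU => ?_⟩
  set U := eLpNorm φ (ENNReal.ofReal t) volume with hUd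
  set G := eLpNorm (diff φ) (ENNReal.ofReal p) (kmeas N s p) with hGd
  rcases eq_or_ne U 0 with hU0 | hU0
  · rw [hU0]; exact zero_le
  rcases eq_or_ne G ∞ with hG | hG
  · have hΩ0 : volume Ω ≠ 0 := by
      intro hz
      apply hU0
      rw [hUd, eLpNorm_congr_ae (g := 0), eLpNorm_zero]
      filter_upwards [h0, measure_eq_zero_iff_ae_notMem.1 hz] with x h1 h2 using h1 h2
    rw [hG, ENNReal.mul_top]
    · exact le_top
    · refine mul_ne_zero ?_ ?_
      · exact (ENNReal.rpow_pos (by simp) (by simpa using hc)).ne'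
      · exact (ENNReal.rpow_pos (pos_iff_ne_zero.2 hΩ0) hΩ.ne).ne'
  have hdens := lintegral_density (s := s) hp0 hφ
  have hfin : ∀ᵐ x, density s p φ x ≠ ∞ := by
    have : ∫⁻ x, density s p φ x ≠ ∞ := by
      rw [hdens]; exact ENNReal.rpow_ne_top_of_nonneg hp0.le hG
    filter_upwards [ae_lt_top' (aemeasurable_density hφ) this] with x hx using hx.ne
  have hta : 0 ≤ t - a := by
    have : a ≤ t := by
      rw [ha, div_le_iff₀ (by positivity), mul_add, mul_div_cancel₀ _ ht0.ne']
      nlinarith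
    linarith
  have hUb : U ^ (t - a) ≠ ∞ := ENNReal.rpow_ne_top_of_nonneg hta hU
  have h1 : U ^ t ≤ c * ((∫⁻ x in Ω, density s p φ x ^ (a / p)) * U ^ (t - a)) := by
    rw [hUd, eLpNorm_rpow_eq_lintegral ht0, lintegral_eq_setLIntegral_of_ae mΩ
      (f := fun x => ‖φ x‖ₑ ^ t) (by filter_upwards [h0] with x hx hx'; simp [hx hx', ht0]),
      ← lintegral_mul_const' _ _ hUb, ← lintegral_const_mul' _ _ hc]
    refine lintegral_mono_ae (ae_restrict_of_ae ?_)
    filter_upwards [hfin] with x hx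
    exact hpt φ hφ hU hU0 x hx
  have h2 : U ^ a ≤ c * ∫⁻ x in Ω, density s p φ x ^ (a / p) := by
    have e : U ^ t = U ^ a * U ^ (t - a) := by
      rw [← ENNReal.rpow_add _ _ hU0 hU]; congr 1; ring
    rw [e, ← mul_assoc] at h1
    -- The cancellation of U^(t-a) is where the a priori finiteness of the L^t norm is needed.
    exact (ENNReal.mul_le_mul_iff_left (ENNReal.rpow_pos (pos_iff_ne_zero.2 hU0) hU).ne' hUb).1 h1
  have h3 : (∫⁻ x in Ω, density s p φ x ^ (a / p)) ^ (1 / (a / p)) ≤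
      G ^ p * volume Ω ^ (1 / (a / p) - 1) := by
    have := lintegral_rpow_le_of_le (a := a / p) (b := 1) (ν := volume.restrict Ω) (by positivity)
      ((div_le_one hp0).2 hap) (aemeasurable_density (s := s) (p := p) hφ).restrict
    simp only [ENNReal.rpow_one, div_one, Measure.restrict_apply_univ] at this
    refine this.trans ?_
    rw [hGd, ← hdens]
    gcongr
    exact Measure.restrict_le_self
  have h4 := ENNReal.rpow_le_rpow h3 (by positivity : 0 ≤ 1 / p)
  rw [← ENNReal.rpow_mul, ENNReal.mul_rpow_of_nonneg _ _ (by positivity), ← ENNReal.rpow_mul,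
    ← ENNReal.rpow_mul, mul_one_div_cancel hp0.ne', ENNReal.rpow_one] at h4
  have h5 := ENNReal.rpow_le_rpow h2 (by positivity : 0 ≤ 1 / a)
  rw [← ENNReal.rpow_mul, mul_one_div_cancel ha0.ne', ENNReal.rpow_one,
    ENNReal.mul_rpow_of_nonneg _ _ (by positivity)] at h5
  have e3 : 1 / (a / p) * (1 / p) = 1 / a := by field_simp
  rw [e3] at h4
  calc U ≤ _ := h5
    _ ≤ (c + 1) ^ (1 / a) * (G * volume Ω ^ ((1 / (a / p) - 1) * (1 / p))) := by
        gcongr; exact le_self_add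
    _ = _ := by ring

/-- The truncation of a function at heights `±k`. -/
def trunc (k : ℝ) (φ : E N → ℝ) (x : E N) : ℝ := max (-k) (min (φ x) k)

lemma abs_trunc_sub_le (k : ℝ) (φ : E N → ℝ) (x y : E N) :
    |trunc k φ x - trunc k φ y| ≤ |φ x - φ y| := by
  unfold trunc
  refine (abs_max_sub_max_le_max _ _ _ _).trans (max_le (by simp) ?_)
  exact (abs_min_sub_min_le_max _ _ _ _).trans (by simp)

/-- The subcritical and critical fractional Sobolev inequality on a set of finite measure. -/
lemma exists_sobolev {t : ℝ} (hN : 1 ≤ N) (hp : 1 < p) (hs : 0 < s) (ht : 1 ≤ t)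
    (htp : (N : ℝ) ≤ s * p + N * p / t) (mΩ : MeasurableSet Ω) (hΩ : volume Ω < ∞) :
    ∃ C : ℝ≥0∞, C ≠ ∞ ∧ ∀ φ : E N → ℝ, AEStronglyMeasurable φ volume →
      (∀ᵐ x, x ∉ Ω → φ x = 0) →
      eLpNorm φ (ENNReal.ofReal t) volume ≤
        C * eLpNorm (diff φ) (ENNReal.ofReal p) (kmeas N s p) := by
  obtain ⟨C, hC, h⟩ := exists_sobolev_of_ne_top hN hp hs ht htp mΩ hΩ
  refine ⟨C, hC, fun φ hφ h0 => ?_⟩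
  have ht0 : 0 < t := by linarith
  have hm : ∀ n : ℕ, AEStronglyMeasurable (trunc n φ) volume := fun n =>
    (aemeasurable_const.max (hφ.aemeasurable.min aemeasurable_const)).aestronglyMeasurable
  -- Truncations are bounded and vanish off a set of finite measure, so they lie in L^t; they do not
  -- increase differences, and lower semicontinuity of the norm passes the bound to φ.
  refine Lp.eLpNorm_le_of_ae_tendsto (u := atTop) (f := fun n : ℕ => trunc n φ)
    (Eventually.of_forall fun n => ?_) hm (Eventually.of_forall fun x => ?_)
  · have h0' : ∀ᵐ x, x ∉ Ω → trunc n φ x = 0 := by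
      filter_upwards [h0] with x hx hx'
      simp [trunc, hx hx']
    refine (h _ (hm n) h0' ?_).trans ?_
    · have hb : ∀ x, ‖trunc n φ x‖ₑ ≤ ENNReal.ofReal n := fun x => by
        rw [Real.enorm_eq_ofReal_abs]
        apply ENNReal.ofReal_le_ofReal
        rw [abs_le]
        have : (0 : ℝ) ≤ n := n.cast_nonneg
        exact ⟨le_max_left _ _, max_le (by linarith) (min_le_right _ _)⟩
      rw [eLpNorm_eq_lintegral ht0, lintegral_eq_setLIntegral_of_ae mΩ
        (f := fun x => ‖trunc n φ x‖ₑ ^ t)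
        (by filter_upwards [h0'] with x hx hx'; simp [hx hx', ht0])]
      refine ENNReal.rpow_ne_top_of_nonneg (by positivity) (ne_of_lt ?_)
      refine lt_of_le_of_lt (lintegral_mono fun x => ENNReal.rpow_le_rpow (hb x) ht0.le) ?_
      rw [setLIntegral_const]
      exact ENNReal.mul_lt_top (ENNReal.rpow_lt_top_of_nonneg ht0.le ENNReal.ofReal_ne_top) hΩ
    · gcongr
      refine eLpNorm_mono fun z => ?_
      exact abs_trunc_sub_le _ φ z.1 z.2
  · refine tendsto_const_nhds.congr' ?_
    obtain ⟨n, hn⟩ := exists_nat_ge |φ x|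
    filter_upwards [eventually_ge_atTop n] with m hm
    have : |φ x| ≤ m := hn.trans (by exact_mod_cast hm)
    rw [abs_le] at this
    rw [trunc, min_eq_left this.2, max_eq_right this.1]

/-! ### The fractional Morrey inequality. -/

lemma isProbabilityMeasure_smul_restrict {α : Type*} [MeasurableSpace α] {ν : Measure α}
    {A : Set α} (h0 : ν A ≠ 0) (h1 : ν A ≠ ∞) :
    IsProbabilityMeasure ((ν A)⁻¹ • ν.restrict A) :=
  ⟨by simp [ENNReal.inv_mul_cancel h0 h1]⟩

lemma enorm_average_le {α : Type*} [MeasurableSpace α] {ν : Measure α} {A : Set α}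
    (h0 : ν A ≠ 0) (h1 : ν A ≠ ∞) (hp : 1 ≤ p) {φ : α → ℝ} (hφ : AEStronglyMeasurable φ ν) :
    ‖⨍ x in A, φ x ∂ν‖ₑ ≤ ((ν A)⁻¹ * ∫⁻ x in A, ‖φ x‖ₑ ^ p ∂ν) ^ (1 / p) := by
  have := isProbabilityMeasure_smul_restrict h0 h1
  rw [setAverage_eq']
  refine (enorm_integral_le_lintegral_enorm _).trans ?_
  have := lintegral_rpow_le_of_le one_pos hp (ν := (ν A)⁻¹ • ν.restrict A)
    (hφ.restrict.smul_measure _).enorm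
  simpa using this

/-- The difference of the two averages is the average of φ(x) - φ(y) over A × B, to which Jensen
applies. -/
lemma enorm_average_sub_average_le {A B : Set (E N)} (hA0 : volume A ≠ 0) (hA1 : volume A ≠ ∞)
    (hB0 : volume B ≠ 0) (hB1 : volume B ≠ ∞) (hp : 1 ≤ p) {φ : E N → ℝ}
    (hφ : AEStronglyMeasurable φ volume) (hφA : IntegrableOn φ A) (hφB : IntegrableOn φ B) :
    ‖(⨍ x in A, φ x) - ⨍ x in B, φ x‖ₑ ≤
      ((volume A)⁻¹ * ((volume B)⁻¹ * ∫⁻ z in A ×ˢ B, ‖diff φ z‖ₑ ^ p)) ^ (1 / p) := by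
  have iA := isProbabilityMeasure_smul_restrict hA0 hA1
  have iB := isProbabilityMeasure_smul_restrict hB0 hB1
  rw [setAverage_eq', setAverage_eq']
  set α := (volume A)⁻¹ • volume.restrict A with hα
  set β := (volume B)⁻¹ • volume.restrict B with hβ
  have iα : Integrable φ α := hφA.smul_measure (ENNReal.inv_ne_top.2 hA0)
  have iβ : Integrable φ β := hφB.smul_measure (ENNReal.inv_ne_top.2 hB0)
  have e : (∫ x, φ x ∂α) - ∫ x, φ x ∂β = ∫ z, diff φ z ∂(α.prod β) := by
    unfold diff
    rw [integral_sub (iα.comp_fst β) (iβ.comp_snd α), integral_fun_fst, integral_fun_snd]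
    simp
  have hac : α.prod β ≪ (volume : Measure (E N × E N)) := by
    rw [Measure.volume_eq_prod]
    exact Measure.AbsolutelyContinuous.prod
      (Measure.smul_absolutelyContinuous.trans Measure.restrict_le_self.absolutelyContinuous)
      (Measure.smul_absolutelyContinuous.trans Measure.restrict_le_self.absolutelyContinuous)
  have hm := (aesm_diff hφ).mono_ac hac
  rw [e]
  refine (enorm_integral_le_lintegral_enorm _).trans ?_
  have h1 := lintegral_rpow_le_of_le one_pos hp hm.enorm
  simp only [ENNReal.rpow_one, div_one, measure_univ, ENNReal.one_rpow, mul_one] at h1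
  refine h1.trans_eq ?_
  congr 1
  rw [lintegral_prod _ (hm.enorm.pow_const p), setLIntegral_prod ((aesm_diff hφ).enorm.pow_const p),
    hα, lintegral_smul_measure, smul_eq_mul,
    ← lintegral_const_mul' _ _ (ENNReal.inv_ne_top.2 hB0)]
  simp only [hβ, lintegral_smul_measure, smul_eq_mul]

/-- On the two balls the kernel is at least (2r)^(-N-sp) off the diagonal, while their volumes
contribute r^(-2N); the p-th root of r^(sp-N) is r^(s-N/p). -/
lemma exists_abs_average_sub_le (hp : 1 < p) (hs : 0 < s) :
    ∃ K : ℝ, 0 ≤ K ∧ ∀ φ : E N → ℝ, MemLp φ (ENNReal.ofReal p) volume →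
      eLpNorm (diff φ) (ENNReal.ofReal p) (kmeas N s p) ≠ ∞ → ∀ x, ∀ r : ℝ, 0 < r →
      |(⨍ y in Metric.closedBall x r, φ y) - ⨍ y in Metric.closedBall x (r / 2), φ y| ≤
        K * r ^ (s - N / p) *
          (eLpNorm (diff φ) (ENNReal.ofReal p) (kmeas N s p)).toReal := by
  have hp0 : 0 < p := by linarith
  set b := (volume (Metric.ball (0 : E N) 1)).toReal with hb
  have hb0 : 0 < b := volume_ball_toReal_pos
  set α := (N : ℝ) + s * p with hαd
  have hα : 0 < α := by positivity
  refine ⟨(b⁻¹ * (b⁻¹ * (2 ^ (N : ℝ) * 2 ^ α))) ^ (1 / p), by positivity,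
    fun φ hφ hG x r hr => ?_⟩
  set G := eLpNorm (diff φ) (ENNReal.ofReal p) (kmeas N s p) with hGd
  have hloc : LocallyIntegrable φ volume := hφ.locallyIntegrable (by
    rw [← ENNReal.ofReal_one]; exact ENNReal.ofReal_le_ofReal hp.le)
  set A := Metric.closedBall x r with hA
  set B := Metric.closedBall x (r / 2) with hB
  have vA : volume A = ENNReal.ofReal (r ^ (N : ℝ) * b) := volume_closedBall x hr.le
  have vB : volume B = ENNReal.ofReal ((r / 2) ^ (N : ℝ) * b) := volume_closedBall x (by positivity)
  have hA0 : volume A ≠ 0 := by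
    rw [vA, Ne, ENNReal.ofReal_eq_zero, not_le]; positivity
  have hB0 : volume B ≠ 0 := by
    rw [vB, Ne, ENNReal.ofReal_eq_zero, not_le]; positivity
  have h1 := enorm_average_sub_average_le hA0 (by rw [vA]; exact ENNReal.ofReal_ne_top) hB0
    (by rw [vB]; exact ENNReal.ofReal_ne_top) hp.le hφ.1
    (hloc.integrableOn_isCompact (isCompact_closedBall x r))
    (hloc.integrableOn_isCompact (isCompact_closedBall x (r / 2)))
  have h2 : ∫⁻ z in A ×ˢ B, ‖diff φ z‖ₑ ^ p ≤ ENNReal.ofReal ((2 * r) ^ α) * G ^ p := by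
    rw [hGd, eLpNorm_rpow_eq_lintegral hp0, lintegral_kmeas,
      ← lintegral_const_mul' _ _ ENNReal.ofReal_ne_top]
    refine (setLIntegral_mono' (measurableSet_closedBall.prod measurableSet_closedBall)
      fun z hz => ?_).trans (setLIntegral_le_lintegral _ _)
    rcases eq_or_ne z.1 z.2 with hzz | hzz
    · simp [diff, hzz, hp0]
    · have hpos : 0 < ‖z.1 - z.2‖ := norm_pos_iff.2 (sub_ne_zero.2 hzz)
      have hle : ‖z.1 - z.2‖ ≤ 2 * r := by
        have h1 := Metric.mem_closedBall.1 hz.1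
        have h2 := Metric.mem_closedBall'.1 hz.2
        rw [← dist_eq_norm]
        linarith [dist_triangle z.1 x z.2]
      rw [← mul_assoc, kernel, ← ENNReal.ofReal_mul (by positivity)]
      refine le_mul_of_one_le_left' ?_
      rw [ENNReal.one_le_ofReal, ← div_eq_mul_inv, one_le_div (by positivity)]
      exact Real.rpow_le_rpow hpos.le hle hα.le
  have h3 : ‖(⨍ x in A, φ x) - ⨍ x in B, φ x‖ₑ ≤
      ((volume A)⁻¹ * ((volume B)⁻¹ * (ENNReal.ofReal ((2 * r) ^ α) * G ^ p))) ^ (1 / p) := by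
    refine h1.trans ?_
    gcongr
  have hfin : ((volume A)⁻¹ * ((volume B)⁻¹ * (ENNReal.ofReal ((2 * r) ^ α) * G ^ p))) ^ (1 / p)
      ≠ ∞ :=
    ENNReal.rpow_ne_top_of_nonneg (by positivity) (ENNReal.mul_ne_top (ENNReal.inv_ne_top.2 hA0)
      (ENNReal.mul_ne_top (ENNReal.inv_ne_top.2 hB0) (ENNReal.mul_ne_top ENNReal.ofReal_ne_top
        (ENNReal.rpow_ne_top_of_nonneg hp0.le hG))))
  have h4 := ENNReal.toReal_mono hfin h3
  rw [vA, vB] at h4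
  simp only [ENNReal.toReal_mul, ← ENNReal.toReal_rpow, toReal_enorm, Real.norm_eq_abs,
    ENNReal.toReal_inv] at h4
  rw [ENNReal.toReal_ofReal (by positivity), ENNReal.toReal_ofReal (by positivity),
    ENNReal.toReal_ofReal (by positivity)] at h4
  refine h4.trans_eq ?_
  set g := G.toReal
  have hg : 0 ≤ g := ENNReal.toReal_nonneg
  have e : (r ^ (N : ℝ) * b)⁻¹ * (((r / 2) ^ (N : ℝ) * b)⁻¹ * ((2 * r) ^ α * g ^ p)) =
      (b⁻¹ * (b⁻¹ * (2 ^ (N : ℝ) * 2 ^ α))) * (r ^ (s - N / p) * g) ^ p := by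
    rw [Real.mul_rpow (by positivity) hg, ← Real.rpow_mul hr.le,
      Real.div_rpow hr.le (by norm_num), Real.mul_rpow (by norm_num) hr.le]
    have e1 : r ^ α = r ^ ((s - N / p) * p) * r ^ (N : ℝ) * r ^ (N : ℝ) := by
      rw [← Real.rpow_add hr, ← Real.rpow_add hr]
      congr 1
      field_simp
      rw [hαd]; ring
    rw [e1]
    have : r ^ (N : ℝ) ≠ 0 := by positivity
    field_simp
  rw [e, Real.mul_rpow (by positivity) (by positivity), ← Real.rpow_mul (by positivity),
    mul_one_div_cancel hp0.ne', Real.rpow_one, mul_assoc]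

/-- The fractional Morrey inequality, in the form of a bound for the supremum. -/
lemma exists_morrey (hp : 1 < p) (hs : 0 < s) (hsp : (N : ℝ) < s * p) :
    ∃ C : ℝ≥0∞, C ≠ ∞ ∧ ∀ φ : E N → ℝ, MemLp φ (ENNReal.ofReal p) volume →
      eLpNorm (diff φ) (ENNReal.ofReal p) (kmeas N s p) ≠ ∞ →
      eLpNorm φ ∞ volume ≤ C * (eLpNorm φ (ENNReal.ofReal p) volume +
        eLpNorm (diff φ) (ENNReal.ofReal p) (kmeas N s p)) := by
  have hp0 : 0 < p := by linarith
  obtain ⟨K, hK, hosc⟩ := exists_abs_average_sub_le (N := N) hp hs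
  set b := (volume (Metric.ball (0 : E N) 1)).toReal with hb
  have hb0 : 0 < b := volume_ball_toReal_pos
  have he : 0 < s - N / p := by rw [sub_pos, div_lt_iff₀ hp0]; exact hsp
  set ρ : ℝ := (1 / 2) ^ (s - N / p) with hρ
  have hρ1 : ρ < 1 := Real.rpow_lt_one (by norm_num) (by norm_num) he
  -- The first entry bounds the average over the unit ball, the second sums the dyadic oscillations,
  -- geometric with ratio ρ < 1 since sp > N.
  set c := max ((b⁻¹) ^ (1 / p)) (K / (1 - ρ)) with hc
  have hc0 : 0 ≤ c := le_max_of_le_left (by positivity)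
  refine ⟨ENNReal.ofReal c, ENNReal.ofReal_ne_top, fun φ hφ hG => ?_⟩
  set U := eLpNorm φ (ENNReal.ofReal p) volume with hU
  set G := eLpNorm (diff φ) (ENNReal.ofReal p) (kmeas N s p) with hGd
  have hUfin : U ≠ ∞ := hφ.2.ne
  have hloc : LocallyIntegrable φ volume := hφ.locallyIntegrable (by
    rw [← ENNReal.ofReal_one]; exact ENNReal.ofReal_le_ofReal hp.le)
  have key : ∀ᵐ x, ‖φ x‖ ≤ c * (U.toReal + G.toReal) := by
    -- At almost every x the averages over balls of radius 2^(-k) converge to φ(x), so telescoping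
    -- from k = 0 bounds φ(x).
    filter_upwards [IsUnifLocDoublingMeasure.ae_tendsto_average (μ := volume) hloc 1] with x hx
    have hlim : Tendsto (fun k : ℕ => ((1 : ℝ) / 2) ^ k) atTop (𝓝[>] 0) :=
      tendsto_nhdsWithin_iff.2 ⟨tendsto_pow_atTop_nhds_zero_of_lt_one (by norm_num) (by norm_num),
        Eventually.of_forall fun k => by simp⟩
    have hx' := hx (fun _ : ℕ => x) (fun k : ℕ => ((1 : ℝ) / 2) ^ k) hlim
      (Eventually.of_forall fun k => Metric.mem_closedBall_self (by positivity))
    set m : ℕ → ℝ := fun k => ⨍ y in Metric.closedBall x ((1 / 2) ^ k), φ y with hm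
    have hstep : ∀ k, dist (m k) (m (k + 1)) ≤ K * G.toReal * ρ ^ k := by
      intro k
      rw [Real.dist_eq]
      have := hosc φ hφ hG x ((1 / 2) ^ k) (by positivity)
      have e1 : ((1 : ℝ) / 2) ^ k / 2 = (1 / 2) ^ (k + 1) := by rw [pow_succ]; ring
      have e2 : (((1 : ℝ) / 2) ^ k) ^ (s - N / p) = ρ ^ k := by
        rw [hρ, ← Real.rpow_natCast, ← Real.rpow_natCast, ← Real.rpow_mul (by norm_num),
          ← Real.rpow_mul (by norm_num), mul_comm]
      rw [e1, e2] at this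
      refine this.trans_eq ?_
      ring
    have h1 := dist_le_of_le_geometric_of_tendsto₀ ρ (K * G.toReal) hρ1 hstep hx'
    have h2 : |m 0| ≤ (b⁻¹) ^ (1 / p) * U.toReal := by
      have vA : volume (Metric.closedBall x 1) = ENNReal.ofReal b := by
        rw [volume_closedBall x zero_le_one, Real.one_rpow, one_mul]
      have hA0 : volume (Metric.closedBall x 1) ≠ 0 := by
        rw [vA, Ne, ENNReal.ofReal_eq_zero, not_le]; exact hb0
      have h3 := enorm_average_le hA0 (by rw [vA]; exact ENNReal.ofReal_ne_top) hp.le hφ.1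
      have h4 : ‖⨍ y in Metric.closedBall x 1, φ y‖ₑ ≤
          ((volume (Metric.closedBall x 1))⁻¹ * U ^ p) ^ (1 / p) := by
        refine h3.trans ?_
        rw [hU, eLpNorm_rpow_eq_lintegral hp0]
        gcongr
        exact Measure.restrict_le_self
      have h5 := ENNReal.toReal_mono (ENNReal.rpow_ne_top_of_nonneg (by positivity)
        (ENNReal.mul_ne_top (ENNReal.inv_ne_top.2 hA0)
          (ENNReal.rpow_ne_top_of_nonneg hp0.le hUfin))) h4
      rw [vA] at h5
      simp only [ENNReal.toReal_mul, ← ENNReal.toReal_rpow, toReal_enorm, Real.norm_eq_abs,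
        ENNReal.toReal_inv, ENNReal.toReal_ofReal hb0.le] at h5
      rw [Real.mul_rpow (by positivity) (by positivity), ← Real.rpow_mul (by positivity),
        mul_one_div_cancel hp0.ne', Real.rpow_one] at h5
      simpa [hm] using h5
    rw [Real.dist_eq] at h1
    rw [Real.norm_eq_abs]
    have hU0 : 0 ≤ U.toReal := ENNReal.toReal_nonneg
    have hG0 : 0 ≤ G.toReal := ENNReal.toReal_nonneg
    have h6 : |φ x| ≤ |m 0| + |m 0 - φ x| := by
      have := abs_sub (m 0) (m 0 - φ x)
      rwa [sub_sub_cancel] at this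
    have h7 : K * G.toReal / (1 - ρ) = K / (1 - ρ) * G.toReal := by ring
    rw [h7] at h1
    have h8 : (b⁻¹) ^ (1 / p) * U.toReal ≤ c * U.toReal :=
      mul_le_mul_of_nonneg_right (le_max_left _ _) hU0
    have h9 : K / (1 - ρ) * G.toReal ≤ c * G.toReal :=
      mul_le_mul_of_nonneg_right (le_max_right _ _) hG0
    linarith
  rw [eLpNorm_exponent_top]
  refine (eLpNormEssSup_le_of_ae_bound key).trans_eq ?_
  rw [ENNReal.ofReal_mul hc0, ENNReal.ofReal_add ENNReal.toReal_nonneg ENNReal.toReal_nonneg,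
    ENNReal.ofReal_toReal hUfin, ENNReal.ofReal_toReal hG]

/-! ### Duality between test functions and the right-hand side. -/

lemma Admissible.exists_eLpNorm_ofReal_le (h : Admissible s p Ω Ω') {t : ℝ} (ht : 1 ≤ t)
    (htp : (N : ℝ) ≤ s * p + N * p / t) :
    ∃ C : ℝ≥0∞, C ≠ ∞ ∧ ∀ φ : E N → ℝ, IsTest s p Ω Ω' φ →
      eLpNorm φ (ENNReal.ofReal t) volume ≤ C * vnorm s p Ω' φ := by
  obtain ⟨C₁, hC₁, h₁⟩ :=
    exists_sobolev h.one_le h.one_lt h.s_pos ht htp h.isOpen.measurableSet h.measure_lt_top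
  obtain ⟨C₂, hC₂, h₂⟩ := h.exists_eLpNorm_diff_le
  refine ⟨C₁ * C₂, ENNReal.mul_ne_top hC₁ hC₂, fun φ hφ => (h₁ φ hφ.aesm hφ.ae_zero).trans ?_⟩
  rw [mul_assoc]
  gcongr
  exact h₂ φ hφ.aesm hφ.ae_zero

lemma Admissible.exists_eLpNorm_top_le (h : Admissible s p Ω Ω') (hsp : (N : ℝ) < s * p) :
    ∃ C : ℝ≥0∞, C ≠ ∞ ∧ ∀ φ : E N → ℝ, IsTest s p Ω Ω' φ →
      eLpNorm φ ∞ volume ≤ C * vnorm s p Ω' φ := by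
  obtain ⟨C₁, hC₁, h₁⟩ := exists_morrey (N := N) h.one_lt h.s_pos hsp
  obtain ⟨C₂, hC₂, h₂⟩ := h.exists_eLpNorm_diff_le
  obtain ⟨C₃, hC₃, h₃⟩ := h.exists_eLpNorm_le_vnorm
  refine ⟨C₁ * (C₃ + C₂), ENNReal.mul_ne_top hC₁ (ENNReal.add_ne_top.2 ⟨hC₃, hC₂⟩),
    fun φ hφ => ?_⟩
  have h4 := h₂ φ hφ.aesm hφ.ae_zero
  refine (h₁ φ (h.isTest_memLp hφ)
    (h4.trans_lt (ENNReal.mul_lt_top hC₂.lt_top hφ.vnorm_lt_top)).ne).trans ?_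
  rw [mul_assoc, add_mul]
  gcongr
  exact h₃ φ hφ.aesm hφ.ae_zero

/-- Test functions embed in the Lebesgue space dual to one containing the right-hand side. -/
lemma Admissible.exists_dual_exponent (h : Admissible s p Ω Ω') {q : ℝ≥0∞}
    (hq : s * p ≠ N → conjExponent N s p ≤ q) (hq' : s * p = N → 1 < q) {f : E N → ℝ}
    (hf : MemLp f q (volume.restrict Ω)) :
    ∃ q₀ t : ℝ≥0∞, ENNReal.HolderConjugate q₀ t ∧ MemLp f q₀ (volume.restrict Ω) ∧
      ∃ C : ℝ≥0∞, C ≠ ∞ ∧ ∀ φ : E N → ℝ, IsTest s p Ω Ω' φ →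
        eLpNorm φ t volume ≤ C * vnorm s p Ω' φ := by
  have hfin : IsFiniteMeasure (volume.restrict Ω) := ⟨by simpa using h.measure_lt_top⟩
  have hN0 : (0 : ℝ) < N := by exact_mod_cast h.one_le
  have hp := h.one_lt
  have hp0 := h.p_pos
  have hsp := h.sp_pos
  rcases lt_trichotomy (s * p) N with hlt | heq | hgt
  · have hden : 0 < N * p - N + s * p := by nlinarith
    have hconj : (N * p / (N * p - N + s * p)).HolderConjugate (N * p / (N - s * p)) := by
      rw [Real.holderConjugate_iff]
      refine ⟨by rw [one_lt_div hden]; linarith, ?_⟩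
      rw [inv_div, inv_div]
      field_simp
      ring
    have hq2 := hq hlt.ne
    rw [conjExponent, if_pos hlt] at hq2
    refine ⟨_, _, hconj.ennrealOfReal, hf.mono_exponent hq2,
      h.exists_eLpNorm_ofReal_le hconj.symm.lt.le ?_⟩
    -- At the critical t = Np/(N-sp) one has Np/t = N - sp, so the Sobolev condition holds with
    -- equality.
    rw [div_div_eq_mul_div, mul_div_cancel_left₀ _ (by positivity)]
    linarith
  · have hq2 := hq' heq
    -- For sp = N every finite t is allowed. Lowering q to min q 2 keeps it finite and above 1, so
    -- its conjugate is a real exponent.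
    have h1 : 1 < min q 2 := lt_min hq2 (by norm_num)
    have htop : min q 2 ≠ ∞ := ((min_le_right q 2).trans_lt (by simp)).ne
    have h1' : 1 < (min q 2).toReal := by
      rw [← ENNReal.toReal_one]; exact (ENNReal.toReal_lt_toReal (by simp) htop).2 h1
    have hconj := Real.HolderConjugate.conjExponent h1'
    have hh := hconj.ennrealOfReal
    rw [ENNReal.ofReal_toReal htop] at hh
    refine ⟨_, _, hh, hf.mono_exponent (min_le_left _ _),
      h.exists_eLpNorm_ofReal_le hconj.symm.lt.le ?_⟩
    have := hconj.symm.pos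
    rw [heq]
    have : 0 ≤ N * p / (min q 2).toReal.conjExponent := by positivity
    linarith
  · have hq2 := hq hgt.ne'
    rw [conjExponent, if_neg (not_lt.2 hgt.le)] at hq2
    exact ⟨1, ∞, inferInstance, hf.mono_exponent hq2, h.exists_eLpNorm_top_le hgt⟩

/-- The right-hand side is a bounded functional of the test function. -/
lemma Admissible.exists_lintegral_mul_le (h : Admissible s p Ω Ω') {q : ℝ≥0∞}
    (hq : s * p ≠ N → conjExponent N s p ≤ q) (hq' : s * p = N → 1 < q) {f : E N → ℝ}
    (hf : MemLp f q (volume.restrict Ω)) :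
    ∃ C : ℝ≥0∞, C ≠ ∞ ∧ ∀ φ : E N → ℝ, IsTest s p Ω Ω' φ →
      ∫⁻ x in Ω, ‖f x * φ x‖ₑ ≤ C * vnorm s p Ω' φ := by
  obtain ⟨q₀, t, hqt, hf₀, C, hC, hb⟩ := h.exists_dual_exponent hq hq' hf
  refine ⟨eLpNorm f q₀ (volume.restrict Ω) * C, ENNReal.mul_ne_top hf₀.2.ne hC, fun φ hφ => ?_⟩
  have := eLpNorm_smul_le_mul_eLpNorm (r := 1) (hpqr := hqt) hφ.aesm.restrict hf₀.1
  rw [eLpNorm_one_eq_lintegral_enorm] at this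
  refine this.trans ?_
  rw [mul_assoc]
  gcongr
  exact (eLpNorm_mono_measure _ Measure.restrict_le_self).trans (hb φ hφ)

/-! ### Completeness of the space of test functions. -/

variable {f g : E N → ℝ}

/-- The space of test functions is complete. -/
lemma Admissible.exists_limit (h : Admissible s p Ω Ω') {φ : ℕ → E N → ℝ}
    (hφ : ∀ n, IsTest s p Ω Ω' (φ n))
    (hcau : ∀ δ : ℝ≥0∞, 0 < δ → ∃ n₀, ∀ n ≥ n₀, ∀ m ≥ n₀, vnorm s p Ω' (φ n - φ m) ≤ δ) :
    ∃ ψ : E N → ℝ, IsTest s p Ω Ω' ψ ∧ ∃ ns : ℕ → ℕ, Tendsto ns atTop atTop ∧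
      (∀ᵐ x, Tendsto (fun k => φ (ns k) x) atTop (𝓝 (ψ x))) ∧
      Tendsto (fun k => vnorm s p Ω' (φ (ns k) - ψ)) atTop (𝓝 0) := by
  obtain ⟨C, hC, hpoinc⟩ := h.exists_eLpNorm_le_vnorm
  obtain ⟨ε, hε, hsum⟩ := ENNReal.exists_pos_sum_of_countable (ε := 1) (by simp) ℕ
  have hε' : ∀ k, (0 : ℝ≥0∞) < ε k / (2 * (C + 1)) := fun k =>
    ENNReal.div_pos (by simpa using (hε k).ne') (by finiteness)
  choose n₀ hn₀ using fun k => hcau _ (hε' k)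
  -- The index exceeds k and all thresholds n₀ 0, ..., n₀ k. By Poincaré the subsequence is then
  -- Cauchy in L^p with summable rates, which gives almost everywhere convergence.
  set ns : ℕ → ℕ := fun k => k + (Finset.range (k + 1)).sup n₀ with hns
  have hge : ∀ k j, k ≤ j → n₀ k ≤ ns j := fun k j hkj =>
    (Finset.le_sup (f := n₀) (Finset.mem_range.2 (Nat.lt_succ_of_le hkj))).trans
      (Nat.le_add_left _ _)
  have hnsT : Tendsto ns atTop atTop :=
    tendsto_atTop_mono (fun k => Nat.le_add_right _ _) tendsto_id
  have hLp : ∀ K n m : ℕ, K ≤ n → K ≤ m →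
      eLpNorm (φ (ns n) - φ (ns m)) (ENNReal.ofReal p) volume < (ε K : ℝ≥0∞) := by
    intro K n m hn hm
    have ht := (hφ (ns n)).sub h.one_lt (hφ (ns m))
    refine (hpoinc _ ht.aesm ht.ae_zero).trans_lt ?_
    have hK0 : (ε K : ℝ≥0∞) ≠ 0 := by simpa using (hε K).ne'
    calc C * vnorm s p Ω' (φ (ns n) - φ (ns m)) ≤ (C + 1) * (ε K / (2 * (C + 1))) := by
          gcongr
          · exact le_self_add
          · exact hn₀ K _ (hge K n hn) _ (hge K m hm)
      _ = ε K / 2 := by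
          have hC1 : C + 1 ≠ ∞ := by finiteness
          have hC2 : C + 1 ≠ 0 := by simp
          rw [← mul_div_assoc, mul_comm (C + 1), ENNReal.mul_div_mul_right _ _ hC2 hC1]
      _ < ε K := ENNReal.half_lt_self hK0 ENNReal.coe_ne_top
  have hae := Lp.ae_tendsto_of_cauchy_eLpNorm (fun n => (hφ (ns n)).aesm) h.one_le_ofReal
    (B := fun k => (ε k : ℝ≥0∞)) (hsum.trans (by simp)).ne hLp
  obtain ⟨ψ, hψm, hψ⟩ := exists_stronglyMeasurable_limit_of_tendsto_ae
    (fun n => (hφ (ns n)).aesm) hae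
  have hdiff : ∀ᵐ z ∂(kmeas N s p).restrict (Ω' ×ˢ Ω'),
      Tendsto (fun k => diff (φ (ns k)) z) atTop (𝓝 (diff ψ z)) := by
    refine ae_restrict_of_ae (kmeas_absolutelyContinuous.ae_le ?_)
    filter_upwards [ae_fst hψ, ae_snd hψ] with z h1 h2 using h1.sub h2
  have hlim : ∀ δ : ℝ≥0∞, 0 < δ → ∀ᶠ k in atTop, vnorm s p Ω' (φ (ns k) - ψ) ≤ δ := by
    intro δ hδ
    obtain ⟨n₁, hn₁⟩ := hcau δ hδ
    filter_upwards [hnsT.eventually_ge_atTop n₁] with k hk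
    -- Fatou in the second index: the Cauchy bound survives the almost everywhere limit of the
    -- differences.
    refine Lp.eLpNorm_le_of_ae_tendsto (u := atTop) (f := fun j => diff (φ (ns k) - φ (ns j)))
      ?_ (fun j => (aesm_diff_kmeas ((hφ _).aesm.sub (hφ _).aesm)).restrict) ?_
    · filter_upwards [hnsT.eventually_ge_atTop n₁] with j hj
      exact hn₁ _ hk _ hj
    · filter_upwards [hdiff] with z hz
      simp only [diff_sub, Pi.sub_apply]
      exact tendsto_const_nhds.sub hz
  have hT : IsTest s p Ω Ω' ψ := by
    refine ⟨hψm.aestronglyMeasurable, ?_, ?_⟩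
    · filter_upwards [hψ, ae_all_iff.2 fun n => (hφ n).ae_zero] with x hx h0 hxΩ
      refine tendsto_nhds_unique hx ?_
      simp [h0 _ hxΩ]
    · obtain ⟨k, hk⟩ := (hlim 1 (by simp)).exists
      have e : ψ = φ (ns k) + (-1 : ℝ) • (φ (ns k) - ψ) := by
        ext x; simp
      rw [e]
      refine (vnorm_add_le h.one_lt (hφ _).aesm
        (((hφ _).aesm.sub hψm.aestronglyMeasurable).const_smul _)).trans_lt ?_
      rw [vnorm_smul]
      exact ENNReal.add_lt_top.2 ⟨(hφ _).vnorm_lt_top, ENNReal.mul_lt_top enorm_lt_top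
        (hk.trans_lt (by simp))⟩
  exact ⟨ψ, hT, ns, hnsT, hψ, ENNReal.tendsto_nhds_zero.2 hlim⟩

/-! ### The energy functional. -/

/-- The assumptions on the data of the Dirichlet problem, with the integrability of the right-hand
side replaced by its boundedness on the space of test functions. -/
structure Problem (s p : ℝ) (Ω Ω' : Set (E N)) (f g : E N → ℝ) : Prop
    extends Admissible s p Ω Ω' where
  memW : MemW s p Ω' g
  memTail : MemTail (p - 1) (s * p) g
  aesm : AEStronglyMeasurable f (volume.restrict Ω)
  exists_bound : ∃ C : ℝ≥0∞, C ≠ ∞ ∧ ∀ φ : E N → ℝ, IsTest s p Ω Ω' φ →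
    ∫⁻ x in Ω, ‖f x * φ x‖ₑ ≤ C * vnorm s p Ω' φ

lemma Admissible.integrable_J_mul (h : Admissible s p Ω Ω') {u φ : E N → ℝ}
    (hu : MemW s p Ω' u) (hu' : MemTail (p - 1) (s * p) u) (hφ : IsTest s p Ω Ω' φ) :
    Integrable (fun z => J p (diff u z) * diff φ z) (kmeas N s p) := by
  obtain ⟨C, hC, hb⟩ := h.exists_lintegral_J_le hu hu'
  refine ⟨?_, (hb φ hφ.aesm hφ.ae_zero).trans_lt (ENNReal.mul_lt_top hC.lt_top hφ.vnorm_lt_top)⟩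
  exact ((continuous_J h.one_lt).comp_aestronglyMeasurable (aesm_diff_kmeas hu'.1)).mul
    (aesm_diff_kmeas hφ.aesm)

/-- The linear part of the energy functional. -/
def linPart (s p : ℝ) (Ω : Set (E N)) (f g φ : E N → ℝ) : ℝ :=
  (∫ x in Ω, f x * φ x) - ∫ z, J p (diff g z) * diff φ z ∂kmeas N s p

/-- The convex part of the energy functional. -/
def bregPart (s p : ℝ) (g φ : E N → ℝ) : ℝ := ∫ z, breg p (diff g z) (diff φ z) ∂kmeas N s p

/-- The energy functional whose minimizers solve the Dirichlet problem. -/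
def energy (s p : ℝ) (Ω : Set (E N)) (f g φ : E N → ℝ) : ℝ :=
  1 / p * bregPart s p g φ - linPart s p Ω f g φ

lemma linPart_smul (c : ℝ) (φ : E N → ℝ) :
    linPart s p Ω f g (c • φ) = c * linPart s p Ω f g φ := by
  unfold linPart
  simp only [diff_smul, Pi.smul_apply, smul_eq_mul, mul_left_comm _ c]
  rw [integral_const_mul, integral_const_mul, mul_sub]

lemma bregPart_nonneg (hp : 1 < p) (φ : E N → ℝ) : 0 ≤ bregPart s p g φ :=
  integral_nonneg fun _ => breg_nonneg hp _ _

namespace Problem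

variable (h : Problem s p Ω Ω' f g)
include h

lemma integrableOn_mul {φ : E N → ℝ} (hφ : IsTest s p Ω Ω' φ) :
    IntegrableOn (fun x => f x * φ x) Ω := by
  obtain ⟨C, hC, hb⟩ := h.exists_bound
  exact ⟨h.aesm.mul hφ.aesm.restrict, (hb φ hφ).trans_lt
    (ENNReal.mul_lt_top hC.lt_top hφ.vnorm_lt_top)⟩

lemma integrable_J {φ : E N → ℝ} (hφ : IsTest s p Ω Ω' φ) :
    Integrable (fun z => J p (diff g z) * diff φ z) (kmeas N s p) :=
  h.integrable_J_mul h.memW h.memTail hφ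

lemma integrable_J_add {φ ψ : E N → ℝ} (hφ : IsTest s p Ω Ω' φ) (hψ : IsTest s p Ω Ω' ψ) :
    Integrable (fun z => J p (diff g z + diff φ z) * diff ψ z) (kmeas N s p) := by
  have hX := h.add_mem_X h.memW h.memTail hφ
  have := h.integrable_J_mul hX.1 hX.2.1 hψ
  rwa [diff_add] at this

lemma aesm_breg {φ : E N → ℝ} (hφ : AEStronglyMeasurable φ volume) :
    AEStronglyMeasurable (fun z => breg p (diff g z) (diff φ z)) (kmeas N s p) :=
  ((measurable_breg p).comp_aemeasurable ((aesm_diff_kmeas h.memTail.1).aemeasurable.prodMk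
    (aesm_diff_kmeas hφ).aemeasurable)).aestronglyMeasurable

/-- The Bregman distance lies between 0 and p (J(Dg+Dφ) - J(Dg)) Dφ, and both products are
integrable although |Dg|^p need not be. -/
lemma integrable_breg {φ : E N → ℝ} (hφ : IsTest s p Ω Ω' φ) :
    Integrable (fun z => breg p (diff g z) (diff φ z)) (kmeas N s p) := by
  refine Integrable.mono' (((h.integrable_J_add hφ hφ).sub (h.integrable_J hφ)).const_mul p)
    (h.aesm_breg hφ.aesm) (Eventually.of_forall fun z => ?_)
  rw [Real.norm_of_nonneg (breg_nonneg h.one_lt _ _)]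
  refine (breg_le h.one_lt _ _).trans_eq ?_
  simp only [Pi.sub_apply]
  ring

lemma linPart_add {φ ψ : E N → ℝ} (hφ : IsTest s p Ω Ω' φ) (hψ : IsTest s p Ω Ω' ψ) :
    linPart s p Ω f g (φ + ψ) = linPart s p Ω f g φ + linPart s p Ω f g ψ := by
  unfold linPart
  simp only [diff_add, Pi.add_apply, mul_add]
  rw [integral_add (h.integrableOn_mul hφ) (h.integrableOn_mul hψ),
    integral_add (h.integrable_J hφ) (h.integrable_J hψ)]
  ring

lemma exists_abs_linPart_le :
    ∃ K : ℝ, 0 ≤ K ∧ ∀ φ : E N → ℝ, IsTest s p Ω Ω' φ →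
      |linPart s p Ω f g φ| ≤ K * (vnorm s p Ω' φ).toReal := by
  obtain ⟨C₁, hC₁, h₁⟩ := h.exists_bound
  obtain ⟨C₂, hC₂, h₂⟩ := h.exists_lintegral_J_le h.memW h.memTail
  refine ⟨(C₁ + C₂).toReal, ENNReal.toReal_nonneg, fun φ hφ => ?_⟩
  have h3 : ‖linPart s p Ω f g φ‖ₑ ≤ (C₁ + C₂) * vnorm s p Ω' φ := by
    unfold linPart
    refine enorm_sub_le.trans ?_
    rw [add_mul]
    exact add_le_add ((enorm_integral_le_lintegral_enorm _).trans (h₁ φ hφ))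
      ((enorm_integral_le_lintegral_enorm _).trans (h₂ φ hφ.aesm hφ.ae_zero))
  have h4 := ENNReal.toReal_mono (ENNReal.mul_ne_top (ENNReal.add_ne_top.2 ⟨hC₁, hC₂⟩)
    hφ.vnorm_lt_top.ne) h3
  rwa [toReal_enorm, Real.norm_eq_abs, ENNReal.toReal_mul] at h4

end Problem

/-! ### Coercivity and uniform convexity of the energy. -/

lemma integrableOn_abs_diff_rpow (hp : 0 < p) {u : E N → ℝ} (hu : AEStronglyMeasurable u volume)
    (hfin : vnorm s p Ω' u ≠ ∞) :
    IntegrableOn (fun z => |diff u z| ^ p) (Ω' ×ˢ Ω') (kmeas N s p) := by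
  have := (show MemLp (diff u) (ENNReal.ofReal p) ((kmeas N s p).restrict (Ω' ×ˢ Ω')) from
    ⟨(aesm_diff_kmeas hu).restrict, hfin.lt_top⟩).integrable_norm_rpow (by simpa using hp)
      ENNReal.ofReal_ne_top
  unfold IntegrableOn
  simpa [ENNReal.toReal_ofReal hp.le] using this

lemma vnorm_toReal_rpow (hp : 0 < p) {u : E N → ℝ} (hu : AEStronglyMeasurable u volume) :
    (vnorm s p Ω' u).toReal ^ p = ∫ z in Ω' ×ˢ Ω', |diff u z| ^ p ∂kmeas N s p := by
  rw [ENNReal.toReal_rpow, vnorm, eLpNorm_rpow_eq_lintegral hp,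
    ← integral_toReal (((aesm_diff_kmeas hu).enorm.pow_const p).restrict)
      (Eventually.of_forall fun z => ENNReal.rpow_lt_top_of_nonneg hp.le enorm_ne_top)]
  simp only [← ENNReal.toReal_rpow, toReal_enorm, Real.norm_eq_abs]

/-- Superlinear growth beats linear growth: for x > 1 the right side is at most (|K|+|M|) x, so
x^(p-1) ≤ |K|+|M|. -/
lemma exists_le_of_rpow_le (hp : 1 < p) (K M : ℝ) :
    ∃ R : ℝ, 0 ≤ R ∧ ∀ x : ℝ, 0 ≤ x → x ^ p ≤ K * x + M → x ≤ R := by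
  set T := |K| + |M| with hT
  have hT0 : 0 ≤ T := by positivity
  refine ⟨max 1 (T ^ (1 / (p - 1))), le_max_of_le_left zero_le_one, fun x hx0 hx => ?_⟩
  by_contra! hlt
  obtain ⟨h1, h2⟩ := max_lt_iff.1 hlt
  have hp1 : 0 < p - 1 := by linarith
  have h3 : T < x ^ (p - 1) := by
    have := Real.rpow_lt_rpow (by positivity) h2 hp1
    rwa [← Real.rpow_mul hT0, one_div_mul_cancel hp1.ne', Real.rpow_one] at this
  have h4 : x ^ p = x ^ (p - 1) * x := by
    rw [← Real.rpow_add_one (by linarith)]; congr 1; ring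
  have h5 : K * x + M ≤ T * x := by
    nlinarith [le_abs_self K, le_abs_self M, abs_nonneg M]
  nlinarith

namespace Problem

variable (h : Problem s p Ω Ω' f g)
include h

/-- Sublevel sets of the energy are bounded. -/
lemma exists_vnorm_le (m : ℝ) :
    ∃ R : ℝ, 0 ≤ R ∧ ∀ φ : E N → ℝ, IsTest s p Ω Ω' φ → energy s p Ω f g φ ≤ m →
      (vnorm s p Ω' φ).toReal ≤ R := by
  have hp := h.p_pos
  obtain ⟨K, hK, hL⟩ := h.exists_abs_linPart_le
  obtain ⟨C, hC, hB⟩ := exists_breg_ge h.one_lt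
  have hgfin := (h.vnorm_lt_top_of_memW h.memW).ne
  set A := (vnorm s p Ω' g).toReal ^ p with hA
  obtain ⟨R, hR0, hR⟩ := exists_le_of_rpow_le h.one_lt (C * (p * K)) (C * (p * m + A))
  refine ⟨R, hR0, fun φ hφ hm => hR _ ENNReal.toReal_nonneg ?_⟩
  -- The coercivity of the Bregman distance is integrated only over Ω' × Ω', where |Dg|^p is
  -- integrable; the remainder of `bregPart` is nonnegative.
  have h1 : (vnorm s p Ω' φ).toReal ^ p ≤ C * (bregPart s p g φ + A) := by
    have i1 := (h.integrable_breg hφ).integrableOn (s := Ω' ×ˢ Ω')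
    have i2 := integrableOn_abs_diff_rpow hp h.memTail.1 hgfin
    rw [vnorm_toReal_rpow hp hφ.aesm, hA, vnorm_toReal_rpow hp h.memTail.1]
    calc ∫ z in Ω' ×ˢ Ω', |diff φ z| ^ p ∂kmeas N s p
        ≤ ∫ z in Ω' ×ˢ Ω', C * (breg p (diff g z) (diff φ z) + |diff g z| ^ p) ∂kmeas N s p :=
          integral_mono (integrableOn_abs_diff_rpow hp hφ.aesm hφ.vnorm_lt_top.ne)
            ((i1.add i2).const_mul C) fun z => hB _ _
      _ = C * (∫ z in Ω' ×ˢ Ω', breg p (diff g z) (diff φ z) ∂kmeas N s p +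
            ∫ z in Ω' ×ˢ Ω', |diff g z| ^ p ∂kmeas N s p) := by
          rw [integral_const_mul, integral_add i1 i2]
      _ ≤ _ := by
          gcongr
          exact setIntegral_le_integral (h.integrable_breg hφ)
            (Eventually.of_forall fun z => breg_nonneg h.one_lt _ _)
  have h2 : bregPart s p g φ ≤ p * (m + K * (vnorm s p Ω' φ).toReal) := by
    have h3 := (le_abs_self _).trans (hL φ hφ)
    unfold energy at hm
    have h4 : 1 / p * bregPart s p g φ ≤ m + K * (vnorm s p Ω' φ).toReal := by linarith
    rwa [one_div, inv_mul_le_iff₀ hp] at h4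
  nlinarith [mul_le_mul_of_nonneg_left h2 hC.le]

/-- Where the energy is nonpositive the norm is at most R by coercivity, so the linear part costs at
most K R; elsewhere 0 is a lower bound. -/
lemma exists_le_energy :
    ∃ m : ℝ, ∀ φ : E N → ℝ, IsTest s p Ω Ω' φ → m ≤ energy s p Ω f g φ := by
  obtain ⟨K, hK, hL⟩ := h.exists_abs_linPart_le
  obtain ⟨R, hR0, hR⟩ := h.exists_vnorm_le 0
  refine ⟨-(K * R), fun φ hφ => ?_⟩
  have hKR : 0 ≤ K * R := by positivity
  rcases le_total (energy s p Ω f g φ) 0 with h0 | h0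
  · have h1 := (le_abs_self _).trans (hL φ hφ)
    have h2 := mul_le_mul_of_nonneg_left (hR φ hφ h0) hK
    have h3 : 0 ≤ 1 / p * bregPart s p g φ :=
      mul_nonneg (by have := h.p_pos; positivity) (bregPart_nonneg h.one_lt φ)
    unfold energy
    linarith
  · linarith

/-- The midpoint convexity gap of the energy. -/
lemma energy_midpoint {φ ψ : E N → ℝ} (hφ : IsTest s p Ω Ω' φ) (hψ : IsTest s p Ω Ω' ψ) :
    Integrable (fun z => gap p (diff (g + φ) z) (diff (g + ψ) z)) (kmeas N s p) ∧
    1 / p * ∫ z, gap p (diff (g + φ) z) (diff (g + ψ) z) ∂kmeas N s p =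
      (energy s p Ω f g φ + energy s p Ω f g ψ) / 2 -
        energy s p Ω f g ((1 / 2 : ℝ) • (φ + ψ)) := by
  have hmid := (hφ.add h.one_lt hψ).smul (1 / 2 : ℝ)
  have i1 := h.integrable_breg hφ
  have i2 := h.integrable_breg hψ
  have i3 := h.integrable_breg hmid
  have e : (fun z => gap p (diff (g + φ) z) (diff (g + ψ) z)) = fun z =>
      (breg p (diff g z) (diff φ z) + breg p (diff g z) (diff ψ z)) / 2 -
        breg p (diff g z) (diff ((1 / 2 : ℝ) • (φ + ψ)) z) := by
    ext z
    rw [diff_add, diff_add, diff_smul, diff_add]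
    simp only [Pi.add_apply, Pi.smul_apply, smul_eq_mul]
    rw [← breg_midpoint]
    congr 2
    ring
  have i12 : Integrable (fun z => (breg p (diff g z) (diff φ z) + breg p (diff g z) (diff ψ z)) / 2)
      (kmeas N s p) := (i1.add i2).div_const 2
  rw [e]
  refine ⟨i12.sub i3, ?_⟩
  rw [integral_sub i12 i3, integral_div, integral_add i1 i2]
  unfold energy
  rw [linPart_smul, h.linPart_add hφ hψ]
  unfold bregPart
  ring

/-- The scalar uniform convexity estimate is integrated over Ω' × Ω'; the gap, being nonnegative, is
then enlarged to the whole space, where `energy_midpoint` evaluates it. -/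
lemma vnorm_sub_rpow_le {ε C : ℝ}
    (hC : ∀ a b : ℝ, |a - b| ^ p ≤ C * gap p a b + ε * (|a| ^ p + |b| ^ p)) (hC0 : 0 ≤ C)
    {φ ψ : E N → ℝ} (hφ : IsTest s p Ω Ω' φ) (hψ : IsTest s p Ω Ω' ψ) :
    (vnorm s p Ω' (φ - ψ)).toReal ^ p ≤
      C * ∫ z, gap p (diff (g + φ) z) (diff (g + ψ) z) ∂kmeas N s p +
        ε * ((vnorm s p Ω' (g + φ)).toReal ^ p + (vnorm s p Ω' (g + ψ)).toReal ^ p) := by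
  have hp := h.p_pos
  have xφ := h.add_mem_X h.memW h.memTail hφ
  have xψ := h.add_mem_X h.memW h.memTail hψ
  have hgap := (h.energy_midpoint hφ hψ).1
  have hsub := hφ.sub h.one_lt hψ
  have i1 := hgap.integrableOn (s := Ω' ×ˢ Ω')
  have i2 := integrableOn_abs_diff_rpow hp xφ.2.1.1 (h.vnorm_lt_top_of_memW xφ.1).ne
  have i3 := integrableOn_abs_diff_rpow hp xψ.2.1.1 (h.vnorm_lt_top_of_memW xψ.1).ne
  have i4 : IntegrableOn (fun z => ε * (|diff (g + φ) z| ^ p + |diff (g + ψ) z| ^ p)) (Ω' ×ˢ Ω')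
      (kmeas N s p) := (i2.add i3).const_mul ε
  rw [vnorm_toReal_rpow hp hsub.aesm, vnorm_toReal_rpow hp xφ.2.1.1, vnorm_toReal_rpow hp xψ.2.1.1]
  calc ∫ z in Ω' ×ˢ Ω', |diff (φ - ψ) z| ^ p ∂kmeas N s p
      ≤ ∫ z in Ω' ×ˢ Ω', (C * gap p (diff (g + φ) z) (diff (g + ψ) z) +
          ε * (|diff (g + φ) z| ^ p + |diff (g + ψ) z| ^ p)) ∂kmeas N s p := by
        refine integral_mono (integrableOn_abs_diff_rpow hp hsub.aesm hsub.vnorm_lt_top.ne)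
          ((i1.const_mul C).add i4) fun z => ?_
        have := hC (diff (g + φ) z) (diff (g + ψ) z)
        have e : diff (g + φ) z - diff (g + ψ) z = diff (φ - ψ) z := by
          simp only [diff_add, diff_sub, Pi.add_apply, Pi.sub_apply]; ring
        rwa [e] at this
    _ = C * ∫ z in Ω' ×ˢ Ω', gap p (diff (g + φ) z) (diff (g + ψ) z) ∂kmeas N s p +
          ε * (∫ z in Ω' ×ˢ Ω', |diff (g + φ) z| ^ p ∂kmeas N s p +
            ∫ z in Ω' ×ˢ Ω', |diff (g + ψ) z| ^ p ∂kmeas N s p) := by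
        rw [integral_add (i1.const_mul C) i4, integral_const_mul,
          integral_const_mul, integral_add i2 i3]
    _ ≤ _ := by
        gcongr
        · exact Eventually.of_forall fun z => gap_nonneg h.one_lt _ _
        · exact Measure.restrict_le_self

/-! ### The direct method and the Euler-Lagrange equation. -/

/-- Minimizing sequences of the energy are Cauchy. -/
lemma cauchy_of_minimizing {φ : ℕ → E N → ℝ} (hφ : ∀ n, IsTest s p Ω Ω' (φ n)) {m : ℝ}
    (hm : ∀ ψ, IsTest s p Ω Ω' ψ → m ≤ energy s p Ω f g ψ)
    (hlim : Tendsto (fun n => energy s p Ω f g (φ n)) atTop (𝓝 m)) :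
    ∀ δ : ℝ≥0∞, 0 < δ → ∃ n₀, ∀ n ≥ n₀, ∀ k ≥ n₀, vnorm s p Ω' (φ n - φ k) ≤ δ := by
  intro δ hδ
  have hp := h.p_pos
  obtain ⟨η, hη0, hηδ⟩ : ∃ η : ℝ, 0 < η ∧ ENNReal.ofReal η ≤ δ := by
    rcases eq_or_ne δ ∞ with rfl | hfin
    · exact ⟨1, one_pos, le_top⟩
    · exact ⟨δ.toReal, ENNReal.toReal_pos hδ.ne' hfin, ENNReal.ofReal_toReal_le⟩
  obtain ⟨R, hR0, hR⟩ := h.exists_vnorm_le (m + 1)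
  set T := (vnorm s p Ω' g).toReal + R with hT
  have hT0 : 0 ≤ T := by positivity
  -- Both ε and κ are chosen so that each of the two error terms is at most η^p/2; the cap κ ≤ 1
  -- keeps the sequence in the sublevel set m + 1, where R applies.
  set ε := η ^ p / (4 * (T ^ p + 1)) with hε
  have hTp : 0 ≤ T ^ p := by positivity
  have hε0 : 0 < ε := by positivity
  obtain ⟨C, hC, hCb⟩ := exists_abs_sub_rpow_le_gap h.one_lt hε0
  set κ := min 1 (η ^ p / (2 * (C * p))) with hκ
  have hκ0 : 0 < κ := by positivity
  obtain ⟨n₀, hn₀⟩ := eventually_atTop.1 (hlim.eventually_lt_const (by linarith : m < m + κ))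
  refine ⟨n₀, fun n hn k hk => ?_⟩
  have en := (hn₀ n hn).le
  have ek := (hn₀ k hk).le
  have hκ1 : κ ≤ 1 := min_le_left _ _
  have hsub := (hφ n).sub h.one_lt (hφ k)
  have hbound : ∀ j, energy s p Ω f g (φ j) ≤ m + κ →
      (vnorm s p Ω' (g + φ j)).toReal ^ p ≤ T ^ p := by
    intro j hj
    refine Real.rpow_le_rpow ENNReal.toReal_nonneg ?_ hp.le
    have hgfin := (h.vnorm_lt_top_of_memW h.memW).ne
    have h1 := ENNReal.toReal_mono (ENNReal.add_ne_top.2 ⟨hgfin, (hφ j).vnorm_lt_top.ne⟩)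
      (vnorm_add_le (s := s) (Ω' := Ω') h.one_lt h.memTail.1 (hφ j).aesm)
    rw [ENNReal.toReal_add hgfin (hφ j).vnorm_lt_top.ne] at h1
    linarith [hR (φ j) (hφ j) (by linarith)]
  -- The midpoint is a competitor, so its energy is at least m, while both endpoints have energy at
  -- most m + κ.
  have hgap : ∫ z, gap p (diff (g + φ n) z) (diff (g + φ k) z) ∂kmeas N s p ≤ p * κ := by
    have h1 := (h.energy_midpoint (hφ n) (hφ k)).2
    have h2 := hm _ (((hφ n).add h.one_lt (hφ k)).smul (1 / 2 : ℝ))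
    rw [← inv_mul_le_iff₀ hp, ← one_div, h1]
    linarith
  have h1 := h.vnorm_sub_rpow_le hCb hC.le (hφ n) (hφ k)
  have h2 : (vnorm s p Ω' (φ n - φ k)).toReal ^ p ≤ η ^ p := by
    have h3 : C * (p * κ) ≤ η ^ p / 2 := by
      have : κ ≤ η ^ p / (2 * (C * p)) := min_le_right _ _
      rw [le_div_iff₀ (by positivity)] at this
      linarith
    have h4 : ε * (T ^ p + T ^ p) ≤ η ^ p / 2 := by
      rw [hε, div_mul_eq_mul_div, div_le_div_iff₀ (by positivity) (by norm_num)]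
      have : 0 ≤ η ^ p := by positivity
      nlinarith
    have h5 := mul_le_mul_of_nonneg_left hgap hC.le
    have h6 := mul_le_mul_of_nonneg_left (add_le_add (hbound n en) (hbound k ek)) hε0.le
    linarith
  have h7 : (vnorm s p Ω' (φ n - φ k)).toReal ≤ η :=
    (Real.rpow_le_rpow_iff ENNReal.toReal_nonneg hη0.le hp).1 h2
  refine le_trans ?_ hηδ
  rw [← ENNReal.ofReal_toReal hsub.vnorm_lt_top.ne]
  exact ENNReal.ofReal_le_ofReal h7

/-- The energy functional has a minimizer. -/
lemma exists_minimizer :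
    ∃ φ, IsTest s p Ω Ω' φ ∧
      ∀ ψ, IsTest s p Ω Ω' ψ → energy s p Ω f g φ ≤ energy s p Ω f g ψ := by
  have hp := h.p_pos
  set S := energy s p Ω f g '' {φ | IsTest s p Ω Ω' φ} with hS
  have hne : S.Nonempty := ⟨_, 0, isTest_zero, rfl⟩
  have hbdd : BddBelow S := by
    obtain ⟨m, hm⟩ := h.exists_le_energy
    exact ⟨m, by rintro _ ⟨φ, hφ, rfl⟩; exact hm φ hφ⟩
  have hm : ∀ ψ, IsTest s p Ω Ω' ψ → sInf S ≤ energy s p Ω f g ψ := fun ψ hψ =>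
    csInf_le hbdd ⟨ψ, hψ, rfl⟩
  obtain ⟨a, -, ha, haS⟩ := exists_seq_tendsto_sInf hne hbdd
  choose φ hφ hφa using haS
  have hlim : Tendsto (fun n => energy s p Ω f g (φ n)) atTop (𝓝 (sInf S)) := by
    simpa only [hφa] using ha
  obtain ⟨ψ, hψ, ns, hns, hae, hv⟩ := h.exists_limit hφ (h.cauchy_of_minimizing hφ hm hlim)
  refine ⟨ψ, hψ, fun χ hχ => le_trans ?_ (hm χ hχ)⟩
  have hlim' := hlim.comp hns
  have hL : Tendsto (fun k => linPart s p Ω f g (φ (ns k))) atTop (𝓝 (linPart s p Ω f g ψ)) := by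
    obtain ⟨K, hK, hKb⟩ := h.exists_abs_linPart_le
    rw [tendsto_iff_norm_sub_tendsto_zero]
    have hv' : Tendsto (fun k => K * (vnorm s p Ω' (φ (ns k) - ψ)).toReal) atTop (𝓝 0) := by
      have := ((ENNReal.tendsto_toReal (by simp : (0 : ℝ≥0∞) ≠ ∞)).comp hv).const_mul K
      simpa using this
    refine squeeze_zero (fun k => norm_nonneg _) (fun k => ?_) hv'
    have hsub := (hφ (ns k)).sub h.one_lt hψ
    have e : linPart s p Ω f g (φ (ns k)) - linPart s p Ω f g ψ =
        linPart s p Ω f g (φ (ns k) - ψ) := by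
      have := h.linPart_add hsub hψ
      rw [sub_add_cancel] at this
      linarith
    rw [e]
    exact hKb _ hsub
  -- The energies and the linear parts converge, hence so do the convex parts. Fatou then bounds the
  -- convex part of the limit by this value.
  have hB : Tendsto (fun k => bregPart s p g (φ (ns k))) atTop
      (𝓝 (p * (sInf S + linPart s p Ω f g ψ))) := by
    refine ((hlim'.add hL).const_mul p).congr fun k => ?_
    simp only [Function.comp_apply, energy, sub_add_cancel]
    rw [← mul_assoc, mul_one_div_cancel hp.ne', one_mul]
  have hnn : 0 ≤ p * (sInf S + linPart s p Ω f g ψ) :=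
    ge_of_tendsto' hB fun k => bregPart_nonneg h.one_lt _
  have hofReal : ∀ χ, IsTest s p Ω Ω' χ → ENNReal.ofReal (bregPart s p g χ) =
      ∫⁻ z, ENNReal.ofReal (breg p (diff g z) (diff χ z)) ∂kmeas N s p := fun χ hχ =>
    ofReal_integral_eq_lintegral_ofReal (h.integrable_breg hχ)
      (Eventually.of_forall fun z => breg_nonneg h.one_lt _ _)
  have hfatou : ENNReal.ofReal (bregPart s p g ψ) ≤
      ENNReal.ofReal (p * (sInf S + linPart s p Ω f g ψ)) := by
    have hpt : ∀ᵐ z ∂kmeas N s p,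
        ENNReal.ofReal (breg p (diff g z) (diff ψ z)) =
          liminf (fun k => ENNReal.ofReal (breg p (diff g z) (diff (φ (ns k)) z))) atTop := by
      refine kmeas_absolutelyContinuous.ae_le ?_
      filter_upwards [ae_fst hae, ae_snd hae] with z h1 h2
      exact (((ENNReal.continuous_ofReal.comp (continuous_breg h.one_lt (diff g z))).tendsto
        (diff ψ z)).comp (h1.sub h2)).liminf_eq.symm
    rw [hofReal ψ hψ, lintegral_congr_ae hpt]
    refine (lintegral_liminf_le' fun k =>
      (h.aesm_breg (hφ (ns k)).aesm).aemeasurable.ennreal_ofReal).trans_eq ?_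
    simp only [← hofReal _ (hφ _)]
    exact ((ENNReal.continuous_ofReal.tendsto _).comp hB).liminf_eq
  have hle := (ENNReal.ofReal_le_ofReal_iff hnn).1 hfatou
  unfold energy
  have : 1 / p * bregPart s p g ψ ≤ sInf S + linPart s p Ω f g ψ := by
    rwa [one_div, inv_mul_le_iff₀ hp]
  linarith

/-- Compare φ with φ + τψ. The tangent inequality at the perturbed point bounds the increase of the
convex part by a quantity linear in τψ; divide by τ > 0 and let τ → 0. The reverse inequality comes
from -ψ. -/
lemma integral_le_of_minimizer {φ ψ : E N → ℝ} (hφ : IsTest s p Ω Ω' φ)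
    (hmin : ∀ χ, IsTest s p Ω Ω' χ → energy s p Ω f g φ ≤ energy s p Ω f g χ)
    (hψ : IsTest s p Ω Ω' ψ) :
    ∫ x in Ω, f x * ψ x ≤ ∫ z, J p (diff (g + φ) z) * diff ψ z ∂kmeas N s p := by
  have hp := h.p_pos
  have hp1 := h.one_lt
  set G : ℝ → E N × E N → ℝ := fun τ z =>
    J p (diff g z + diff φ z + τ * diff ψ z) * diff ψ z with hG
  have hGint : ∀ τ, Integrable (G τ) (kmeas N s p) := fun τ => by
    have := h.integrable_J_add (hφ.add hp1 (hψ.smul τ)) hψ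
    simpa only [diff_add, diff_smul, Pi.add_apply, Pi.smul_apply, smul_eq_mul, ← add_assoc]
      using this
  have hτ : ∀ τ : ℝ, 0 < τ → ∫ x in Ω, f x * ψ x ≤ ∫ z, G τ z ∂kmeas N s p := by
    intro τ hτ
    have htest := hφ.add hp1 (hψ.smul τ)
    have h1 := hmin _ htest
    unfold energy at h1
    rw [h.linPart_add hφ (hψ.smul τ), linPart_smul] at h1
    have h2 : bregPart s p g (φ + τ • ψ) - bregPart s p g φ ≤
        p * (τ * ((∫ z, G τ z ∂kmeas N s p) -
          ∫ z, J p (diff g z) * diff ψ z ∂kmeas N s p)) := by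
      unfold bregPart
      rw [← integral_sub (h.integrable_breg htest) (h.integrable_breg hφ),
        ← integral_sub (hGint τ) (h.integrable_J hψ), ← integral_const_mul, ← integral_const_mul]
      refine integral_mono ((h.integrable_breg htest).sub (h.integrable_breg hφ))
        ((((hGint τ).sub (h.integrable_J hψ)).const_mul τ).const_mul p) fun z => ?_
      simp only [diff_add, diff_smul, Pi.add_apply, Pi.smul_apply, smul_eq_mul]
      refine (breg_add_sub_le hp1 _ _ _).trans_eq ?_
      simp only [hG]
      ring
    have h3 : 1 / p * (bregPart s p g (φ + τ • ψ) - bregPart s p g φ) ≤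
        τ * ((∫ z, G τ z ∂kmeas N s p) - ∫ z, J p (diff g z) * diff ψ z ∂kmeas N s p) := by
      rwa [one_div, inv_mul_le_iff₀ hp]
    have h4 : τ * linPart s p Ω f g ψ ≤
        τ * ((∫ z, G τ z ∂kmeas N s p) - ∫ z, J p (diff g z) * diff ψ z ∂kmeas N s p) := by
      linarith
    have h5 := le_of_mul_le_mul_left h4 hτ
    unfold linPart at h5
    linarith
  have hlim : Tendsto (fun n : ℕ => ∫ z, G (1 / ((n : ℝ) + 1)) z ∂kmeas N s p) atTop
      (𝓝 (∫ z, J p (diff (g + φ) z) * diff ψ z ∂kmeas N s p)) := by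
    -- For 0 ≤ τ ≤ 1, |J(a+τb)| ≤ 2^(p-1)(|a|^(p-1) + |b|^(p-1)). The second term is integrable
    -- since the weak form at ψ is bounded too.
    have ib : Integrable (fun z => 2 ^ (p - 1) *
        (‖J p (diff g z + diff φ z) * diff ψ z‖ + ‖J p (diff ψ z) * diff ψ z‖)) (kmeas N s p) :=
      ((h.integrable_J_add hφ hψ).norm.add (h.integrable_J_mul (h.isTest_memW hψ)
        (h.isTest_memTail hψ) hψ).norm).const_mul _
    refine tendsto_integral_of_dominated_convergence _ (fun n => (hGint _).1) ib
      (fun n => Eventually.of_forall fun z => ?_) (Eventually.of_forall fun z => ?_)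
    · simp only [hG, norm_mul, Real.norm_eq_abs, abs_J hp1]
      rw [← add_mul, ← mul_assoc]
      refine mul_le_mul_of_nonneg_right ?_ (abs_nonneg _)
      refine (abs_add_rpow_le (by linarith) _ _).trans ?_
      refine mul_le_mul_of_nonneg_left (add_le_add_right ?_ _) (by positivity)
      · refine Real.rpow_le_rpow (abs_nonneg _) ?_ (by linarith)
        rw [abs_mul]
        refine mul_le_of_le_one_left (abs_nonneg _) ?_
        rw [abs_of_nonneg (by positivity), div_le_one (by positivity)]
        linarith [n.cast_nonneg (α := ℝ)]
    · have h0 : Tendsto (fun n : ℕ => diff g z + diff φ z + 1 / ((n : ℝ) + 1) * diff ψ z) atTop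
          (𝓝 (diff (g + φ) z)) := by
        have := ((tendsto_one_div_add_atTop_nhds_zero_nat (𝕜 := ℝ)).mul_const
          (diff ψ z)).const_add (diff g z + diff φ z)
        simpa [diff_add] using this
      exact (((continuous_J hp1).tendsto _).comp h0).mul_const _
  exact ge_of_tendsto' hlim fun n => hτ _ (by positivity)

/-- Existence of a weak solution. -/
lemma exists_isWeakSolution : ∃ u, IsWeakSolution s p Ω Ω' f g u := by
  obtain ⟨φ, hφ, hmin⟩ := h.exists_minimizer
  have hX := h.add_mem_X h.memW h.memTail hφ
  refine ⟨g + φ, hX, fun ψ hψ => ?_⟩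
  rw [h.mem_X_zero_iff] at hψ
  refine ⟨integrable_weakIntegrand_iff.2 (h.integrable_J_mul hX.1 hX.2.1 hψ),
    h.integrableOn_mul hψ, ?_⟩
  rw [integral_weakIntegrand]
  refine le_antisymm ?_ (h.integral_le_of_minimizer hφ hmin hψ)
  have h1 := h.integral_le_of_minimizer hφ hmin hψ.neg
  have e : diff (-ψ) = -diff ψ := by simpa using diff_smul (-1) ψ
  simp only [e, Pi.neg_apply, mul_neg, integral_neg] at h1
  linarith

end Problem

/-- Uniqueness of the weak solution. -/
lemma Admissible.ae_eq_of_isWeakSolution (h : Admissible s p Ω Ω') {u v : E N → ℝ}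
    (hu : IsWeakSolution s p Ω Ω' f g u) (hv : IsWeakSolution s p Ω Ω' f g v) :
    v =ᵐ[volume] u := by
  have hw := h.isTest_sub hv.1 hu.1
  obtain ⟨iu, -, eu⟩ := hu.2 _ (h.mem_X_zero_iff.2 hw)
  obtain ⟨iv, -, ev⟩ := hv.2 _ (h.mem_X_zero_iff.2 hw)
  rw [integrable_weakIntegrand_iff] at iu iv
  rw [integral_weakIntegrand] at eu ev
  have e : (fun z => J p (diff v z) * diff (v - u) z - J p (diff u z) * diff (v - u) z) =
      fun z => (J p (diff v z) - J p (diff u z)) * (diff v z - diff u z) := by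
    ext z
    rw [diff_sub, Pi.sub_apply]
    ring
  have h0 : ∫ z, (J p (diff v z) - J p (diff u z)) * (diff v z - diff u z) ∂kmeas N s p = 0 := by
    rw [← e, integral_sub iv iu, ev, eu, sub_self]
  have hi := iv.sub iu
  -- A nonnegative integrand with zero integral vanishes, so strict monotonicity gives D(v-u) = 0
  -- almost everywhere, and Poincaré removes the additive constant.
  have hae := (integral_eq_zero_iff_of_nonneg (fun z => J_sub_mul_nonneg h.one_lt _ _)
    (e ▸ hi)).1 h0
  have hz : diff (v - u) =ᵐ[kmeas N s p] 0 := by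
    filter_upwards [hae] with z hz
    rw [diff_sub, Pi.sub_apply, eq_of_J_sub_mul_eq_zero h.one_lt hz, sub_self, Pi.zero_apply]
  obtain ⟨C, -, hpoinc⟩ := h.exists_eLpNorm_le_vnorm
  have h1 := hpoinc _ hw.aesm hw.ae_zero
  have h2 : vnorm s p Ω' (v - u) = 0 := by
    rw [vnorm, eLpNorm_congr_ae (ae_restrict_of_ae hz), eLpNorm_zero]
  rw [h2, mul_zero, nonpos_iff_eq_zero,
    eLpNorm_eq_zero_iff hw.aesm (by simpa using h.p_pos)] at h1
  filter_upwards [h1] with x hx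
  exact sub_eq_zero.1 hx

end FracPLap

end

theorem proposition2p7 (N : ℕ) (hN : 1 ≤ N) (s p : ℝ) (hp : 1 < p) (hs0 : 0 < s) (hs1 : s < 1)
    (Ω Ω' : Set (FracPLap.E N))
    (hΩ : IsOpen Ω) (hΩ' : IsOpen Ω')
    (hΩb : Bornology.IsBounded Ω) (hΩ'b : Bornology.IsBounded Ω')
    (hΩΩ' : closure Ω ⊆ Ω')
    (q : ℝ≥0∞)
    (hq : s * p ≠ N → FracPLap.conjExponent N s p ≤ q)
    (hq' : s * p = N → 1 < q)
    (f g : FracPLap.E N → ℝ)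
    (hf : MemLp f q (volume.restrict Ω))
    (hg : FracPLap.MemW s p Ω' g)
    (hg' : FracPLap.MemTail (p - 1) (s * p) g) :
    ∃ u : FracPLap.E N → ℝ, FracPLap.IsWeakSolution s p Ω Ω' f g u ∧
      ∀ v : FracPLap.E N → ℝ, FracPLap.IsWeakSolution s p Ω Ω' f g v →
        v =ᵐ[(volume : Measure (FracPLap.E N))] u := by
  have hA : FracPLap.Admissible s p Ω Ω' := ⟨hN, hp, hs0, hΩ, hΩ', hΩb, hΩ'b, hΩΩ'⟩
  have hP : FracPLap.Problem s p Ω Ω' f g :=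
    ⟨hA, hg, hg', hf.1, hA.exists_lintegral_mul_le hq hq' hf⟩
  obtain ⟨u, hu⟩ := hP.exists_isWeakSolution
  exact ⟨u, hu, fun v hv => hA.ae_eq_of_isWeakSolution hu hv⟩
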